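/- Let $m\ge 1$. For functions on $\mathbb R^m$ write $$(-\Delta)^{\frac s2}f(x)=c_s\lim_{\varepsilon\to0}\int_{|x-y|>\varepsilon}\frac{f(x)-f(y)}{|x-y|^{m+s}}\,dy\quad(0<s<2),\qquad I_sf(x)=\tilde c_s\int_{\mathbb R^m}\frac{f(y)}{|x-y|^{m-s}}\,dy\quad(0<s<m),$$ $$\mathcal R_jf(x)=c_m\lim_{\varepsilon\to0}\int_{|x-y|>\varepsilon}\frac{x_j-y_j}{|x-y|^{m+1}}f(y)\,dy\quad(1\le j\le m),$$ where $c_s,\tilde c_s,c_m>0$ are the usual constants (depending also on $m$), for which these operators have the Fourier symbols $|\xi|^s$, $|\xi|^{-s}$ and $-i\xi_j/|\xi|$, and let $\mathcal C(a,T)[b]=a\,T[b]-T[ab]$. (i) Let $s>0$, $\delta>0$ with $s+\delta<1$, and let $\gamma\in(s,s+\delta)$. There is a constant $C=C_{m,s,\delta,\gamma}$ such that for all (real- or complex-valued) Schwartz functions $a,b$ on $\mathbb R^m$ and all $x\in\mathbb R^m$ the limits defining $(-\Delta)^{\frac{s+\delta}2}a(x)$ and $(-\Delta)^{\frac s2}\mathcal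 C(a,I_s)[b](x)$ exist and, at $x$, $$\begin{aligned}\bigl|(-\Delta)^{\frac s2}\mathcal C(a,I_s)[b]\bigr|\le{}& C\; I_{s+\delta-\gamma}\bigl|(-\Delta)^{\frac{s+\delta}2}a\bigr|\;\cdot\; I_{\gamma-s}\bigl|I_sb\bigr|\\&+C\min\Bigl\{I_{\gamma-s}\Bigl(|I_sb|\;I_{s+\delta-\gamma}\bigl|(-\Delta)^{\frac{s+\delta}2}a\bigr|\Bigr),\; I_{\gamma-s}\Bigl(I_{s+\delta-\gamma}|I_sb|\;\bigl|(-\Delta)^{\frac{s+\delta}2}a\bigr|\Bigr)\Bigr\}.\end{aligned}$$ (ii) Let $\delta\in(0,1)$ and $1\le j\le m$. There are constants $C_\gamma=C_{m,j,\delta,\gamma}$, $\gamma\in(0,\delta)$, such that for all $\gamma_1,\gamma_2\in(0,\delta)$, all (real- or complex-valued) Schwartz functions $a,b$ on $\mathbb R^m$ and all $x\in\mathbb R^m$ the limits defining $(-\Delta)^{\frac\delta2}a(x)$, $\mathcal R_j[b](x)$ and $\mathcal R_j[ab](x)$ exist and, at $x$, $$\bigl|\mathcal C(a,\mathcal R_j)[b]\bigr|\le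 C_{\gamma_1}\; I_{\delta-\gamma_1}\bigl|(-\Delta)^{\frac\delta2}a\bigr|\;\cdot\; I_{\gamma_1}|b|+C_{\gamma_2}\; I_{\gamma_2}\Bigl(I_{\delta-\gamma_2}|b|\;\bigl|(-\Delta)^{\frac\delta2}a\bigr|\Bigr).$$ -/

import Mathlib

open Set Filter Topology MeasureTheory
open scoped SchwartzMap

namespace FracComm

/-- Normalising constant for which the hypersingular integral below has Fourier symbol `|ξ|^s`. -/
noncomputable def fracLaplacianConst (m : ℕ) (s : ℝ) : ℝ :=
  2 ^ s * Real.Gamma ((m + s) / 2) / (Real.pi ^ ((m : ℝ) / 2) * |Real.Gamma (-s / 2)|)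

/-- Normalising constant for which the Riesz potential below has Fourier symbol `|ξ|^(-s)`. -/
noncomputable def rieszPotentialConst (m : ℕ) (s : ℝ) : ℝ :=
  Real.Gamma ((m - s) / 2) / (Real.pi ^ ((m : ℝ) / 2) * 2 ^ s * Real.Gamma (s / 2))

/-- Normalising constant for which the Riesz transforms below have symbol `-i ξ_j / |ξ|`. -/
noncomputable def rieszTransformConst (m : ℕ) : ℝ :=
  Real.Gamma (((m : ℝ) + 1) / 2) / Real.pi ^ (((m : ℝ) + 1) / 2)

section

variable {m : ℕ} {F : Type*} [NormedAddCommGroup F] [NormedSpace ℝ F]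

/-- The integrand of the hypersingular integral for `(-Δ)^(s/2) f (x)`. -/
noncomputable def fracLaplacianIntegrand (s : ℝ) (f : EuclideanSpace ℝ (Fin m) → F)
    (x y : EuclideanSpace ℝ (Fin m)) : F :=
  (‖x - y‖ ^ (-((m : ℝ) + s))) • (f x - f y)

/-- The truncated integral `c_s ∫_{|x-y|>ε} (f(x) - f(y)) / |x-y|^(m+s) dy`. -/
noncomputable def truncFracLaplacian (s : ℝ) (f : EuclideanSpace ℝ (Fin m) → F)
    (x : EuclideanSpace ℝ (Fin m)) (ε : ℝ) : F :=
  fracLaplacianConst m s • ∫ y in {y | ε < ‖x - y‖}, fracLaplacianIntegrand s f x y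

/-- The value `(-Δ)^(s/2) f (x)` is well defined: all truncated integrals converge absolutely
and they have a limit as the truncation is removed. -/
def FracLaplacianExists (s : ℝ) (f : EuclideanSpace ℝ (Fin m) → F)
    (x : EuclideanSpace ℝ (Fin m)) : Prop :=
  (∀ ε : ℝ, 0 < ε → IntegrableOn (fracLaplacianIntegrand s f x) {y | ε < ‖x - y‖}) ∧
    ∃ v : F, Tendsto (truncFracLaplacian s f x) (𝓝[>] 0) (𝓝 v)

/-- The fractional Laplacian
`(-Δ)^(s/2) f (x) = c_s lim_{ε → 0} ∫_{|x-y|>ε} (f(x) - f(y)) / |x-y|^(m+s) dy`, `0 < s < 2`. -/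
noncomputable def fracLaplacian (s : ℝ) (f : EuclideanSpace ℝ (Fin m) → F)
    (x : EuclideanSpace ℝ (Fin m)) : F :=
  haveI : Nonempty F := ⟨0⟩
  limUnder (𝓝[>] (0 : ℝ)) (truncFracLaplacian s f x)

/-- The Riesz potential `I_s f (x) = (-Δ)^(-s/2) f (x) = c ∫ f(y) / |x-y|^(m-s) dy`, `0 < s < m`. -/
noncomputable def rieszPotential (s : ℝ) (f : EuclideanSpace ℝ (Fin m) → F)
    (x : EuclideanSpace ℝ (Fin m)) : F :=
  rieszPotentialConst m s • ∫ y, (‖x - y‖ ^ (-((m : ℝ) - s))) • f y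

/-- The integrand of the singular integral for the `j`-th Riesz transform. -/
noncomputable def rieszTransformIntegrand (j : Fin m) (f : EuclideanSpace ℝ (Fin m) → F)
    (x y : EuclideanSpace ℝ (Fin m)) : F :=
  ((x j - y j) / ‖x - y‖ ^ (m + 1)) • f y

/-- The truncated integral `c ∫_{|x-y|>ε} (x_j - y_j) / |x-y|^(m+1) f(y) dy`. -/
noncomputable def truncRieszTransform (j : Fin m) (f : EuclideanSpace ℝ (Fin m) → F)
    (x : EuclideanSpace ℝ (Fin m)) (ε : ℝ) : F :=
  rieszTransformConst m • ∫ y in {y | ε < ‖x - y‖}, rieszTransformIntegrand j f x y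

/-- The principal value `R_j f (x)` is well defined. -/
def RieszTransformExists (j : Fin m) (f : EuclideanSpace ℝ (Fin m) → F)
    (x : EuclideanSpace ℝ (Fin m)) : Prop :=
  (∀ ε : ℝ, 0 < ε → IntegrableOn (rieszTransformIntegrand j f x) {y | ε < ‖x - y‖}) ∧
    ∃ v : F, Tendsto (truncRieszTransform j f x) (𝓝[>] 0) (𝓝 v)

/-- The `j`-th Riesz transform
`R_j f (x) = c lim_{ε → 0} ∫_{|x-y|>ε} (x_j - y_j) / |x-y|^(m+1) f(y) dy`. -/
noncomputable def rieszTransform (j : Fin m) (f : EuclideanSpace ℝ (Fin m) → F)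
    (x : EuclideanSpace ℝ (Fin m)) : F :=
  haveI : Nonempty F := ⟨0⟩
  limUnder (𝓝[>] (0 : ℝ)) (truncRieszTransform j f x)

end

/-- The commutator `C(a,T)[b] = a T[b] - T[a b]`. -/
def commutator {X 𝕜 : Type*} [Ring 𝕜] (a : X → 𝕜) (T : (X → 𝕜) → X → 𝕜) (b : X → 𝕜) : X → 𝕜 :=
  fun x => a x * T b x - T (fun y => a y * b y) x

end FracComm

open FracComm

/-! Put `α = s + δ` in (i), `α = δ` and `s = 0` in (ii), and `A = (-Δ)^(α/2) a`. Both commutators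
are dominated at `x` by a constant times the same integral of `|x-y|^(-(m+s)) |a(x) - a(y)| |v(y)|`
over `y`, with `v = I_s b` in (i) and `v = b` in (ii). In (ii) this holds for every truncation,
because the Riesz kernel is at most `|w|^(-m)`. In (i) it rests on a cancellation: `(-Δ)^(s/2) I_s`
is a multiple of the identity, so `(-Δ)^(s/2) I_s[ab] = a (-Δ)^(s/2) I_s b`, and subtracting this
from `(-Δ)^(s/2)(a I_s b)` leaves only the difference of `a` (`hyper_commutator_rieszPotential`).

Next, `a` is a multiple of the convolution of `|w|^(α-m)` with `A`
(`exists_eq_integral_fracLaplacian`). It remains to bound `| |x-z|^(α-m) - |y-z|^(α-m) |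
|x-y|^(-(m+s))`, integrated against `|A(z)| |v(y)|`. Write `p = |x-z|`, `q = |y-z|`, `r = |x-y|`. If
`r ≤ p/2` the mean value theorem applies, and if `p ≤ r/2` the term in `p` dominates; both zones
give the product kernel `p^(-(m-(α-γ))) r^(-(m-(γ-s)))`. If `p` and `r` are comparable, only `q` can
be small, and `q^(-(m-(α-γ)))` times the power `-(m-(γ-s))` of either `r` or `p` is a bound
(`kernel_le`). Tonelli turns the product kernel into a product of potentials, and the other two into
the two nested potentials of the minimum (`lintegral_kernel_le`).

The inversion `I_α (-Δ)^(α/2) = const` (`exists_riesz_hyper`) is proved by Fourier analysis. The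
symbol of the hypersingular integral is a positive multiple of `|ξ|^α` by scaling, rotation
invariance and positivity of `1 - cos`; the Riesz kernel is a superposition of Gaussians, and for
each Gaussian the multiplication formula applies.

All orders are below 1, so the hypersingular integrals of bounded Lipschitz functions converge
absolutely and Fubini is available. The exact normalising constants are immaterial: for the
fractional Laplacian and the Riesz potential only positivity is used. -/

namespace FracComm

open scoped ENNReal FourierTransform

/-! ### Power kernels -/

/-- Euclidean space of dimension `m`. -/
abbrev Eucl (m : ℕ) := EuclideanSpace ℝ (Fin m)

lemma nontrivial_eucl {m : ℕ} (hm : 1 ≤ m) : Nontrivial (Eucl m) := by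
  have : Nonempty (Fin m) := ⟨⟨0, hm⟩⟩
  infer_instance

/-- The integrable weight `(1 + ‖x‖)^(-(m+1))`. -/
noncomputable def decay {m : ℕ} (x : Eucl m) : ℝ := (1 + ‖x‖) ^ (-((m : ℝ) + 1))

section

variable {m : ℕ}

lemma decay_nonneg (x : Eucl m) : 0 ≤ decay x := by unfold decay; positivity

lemma decay_le_one (x : Eucl m) : decay x ≤ 1 := by
  unfold decay
  apply Real.rpow_le_one_of_one_le_of_nonpos
  · linarith [norm_nonneg x]
  · have : (0 : ℝ) ≤ m := Nat.cast_nonneg m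
    linarith

lemma continuous_decay : Continuous (decay : Eucl m → ℝ) := by
  unfold decay
  refine Continuous.rpow_const (by fun_prop) fun x => Or.inl ?_
  have := norm_nonneg x
  positivity

lemma integrable_decay : Integrable (decay : Eucl m → ℝ) := by
  apply integrable_one_add_norm
  simp

lemma lintegral_decay_ne_top : ∫⁻ x : Eucl m, ENNReal.ofReal (decay x) ≠ ∞ :=
  integrable_decay.lintegral_lt_top.ne

lemma measurable_norm_rpow (r : ℝ) : Measurable fun w : Eucl m => ‖w‖ ^ r := by fun_prop

/-- In polar coordinates the radial density is `t^(m-1) t^(-(m-β)) = t^(β-1)`, integrable at `0`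
exactly because `β > 0`. -/
lemma lintegral_near_ne_top (hm : 1 ≤ m) {β : ℝ} (hβ : 0 < β) :
    ∫⁻ w : Eucl m in {w | ‖w‖ ≤ 1}, ENNReal.ofReal (‖w‖ ^ (-((m : ℝ) - β))) ≠ ∞ := by
  have := nontrivial_eucl hm
  have key : Integrable fun w : Eucl m => (Iic (1 : ℝ)).indicator
      (fun t : ℝ => t ^ (-((m : ℝ) - β))) ‖w‖ := by
    rw [integrable_fun_norm_addHaar volume
      (f := (Iic (1 : ℝ)).indicator (fun t : ℝ => t ^ (-((m : ℝ) - β))))]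
    have h1 : IntegrableOn (fun t : ℝ => t ^ (β - 1)) (Ioc 0 1) := by
      rw [← intervalIntegrable_iff_integrableOn_Ioc_of_le zero_le_one]
      exact intervalIntegral.intervalIntegrable_rpow' (by linarith)
    have h2 : IntegrableOn ((Ioc (0 : ℝ) 1).indicator (fun t : ℝ => t ^ (β - 1))) (Ioi 0) :=
      (h1.integrable_indicator measurableSet_Ioc).integrableOn
    refine h2.congr_fun (fun t ht => ?_) measurableSet_Ioi
    have ht' : (0 : ℝ) < t := ht
    by_cases h : t ≤ 1
    · rw [indicator_of_mem (show t ∈ Ioc (0 : ℝ) 1 from ⟨ht, h⟩),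
        indicator_of_mem (show t ∈ Iic (1 : ℝ) from h)]
      simp only [finrank_euclideanSpace, Fintype.card_fin, smul_eq_mul]
      rw [← Real.rpow_natCast, ← Real.rpow_add ht', Nat.cast_sub hm]
      congr 1; push_cast; ring
    · rw [indicator_of_notMem (show t ∉ Ioc (0 : ℝ) 1 from fun h' => h h'.2),
        indicator_of_notMem (show t ∉ Iic (1 : ℝ) from h)]
      simp
  have hset : MeasurableSet {w : Eucl m | ‖w‖ ≤ 1} := measurableSet_le measurable_norm measurable_const
  rw [← lintegral_indicator hset]
  refine (lt_of_le_of_lt (lintegral_mono fun w => ?_) key.lintegral_lt_top).ne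
  by_cases h : ‖w‖ ≤ 1
  · rw [indicator_of_mem (show w ∈ {w : Eucl m | ‖w‖ ≤ 1} from h),
      indicator_of_mem (show ‖w‖ ∈ Iic (1 : ℝ) from h)]
  · rw [indicator_of_notMem (show w ∉ {w : Eucl m | ‖w‖ ≤ 1} from h)]
    exact zero_le

lemma lintegral_far_ne_top {r : ℝ} (hr : (m : ℝ) < r) :
    ∫⁻ w : Eucl m in {w | 1 < ‖w‖}, ENNReal.ofReal (‖w‖ ^ (-r)) ≠ ∞ := by
  have key : Integrable fun w : Eucl m => 2 ^ r * (1 + ‖w‖) ^ (-r) :=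
    (integrable_one_add_norm (by simpa using hr)).const_mul _
  refine (lt_of_le_of_lt ?_ key.lintegral_lt_top).ne
  refine (setLIntegral_mono' (measurableSet_lt measurable_const measurable_norm)
    fun w (hw : 1 < ‖w‖) => ?_).trans (setLIntegral_le_lintegral _ _)
  apply ENNReal.ofReal_le_ofReal
  have h0 : 0 < ‖w‖ := by linarith
  have hr0 : 0 ≤ r := (Nat.cast_nonneg m).trans hr.le
  rw [Real.rpow_neg h0.le, Real.rpow_neg (by positivity), ← div_eq_mul_inv,
    ← Real.div_rpow (by positivity) (by positivity), ← Real.inv_rpow h0.le]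
  apply Real.rpow_le_rpow (by positivity) _ hr0
  rw [inv_eq_one_div, div_le_div_iff₀ h0 (by positivity)]
  linarith

/-- Near the origin the factor `‖w‖` improves the kernel to `‖w‖^(-(m-(1-s)))`, which needs `s < 1`;
at infinity `s > 0` suffices. This weight dominates every hypersingular integrand below. -/
lemma lintegral_levy_ne_top (hm : 1 ≤ m) {s : ℝ} (hs : 0 < s) (hs1 : s < 1) :
    ∫⁻ w : Eucl m, ENNReal.ofReal (‖w‖ ^ (-((m : ℝ) + s)) * min 1 ‖w‖) ≠ ∞ := by
  have hset : MeasurableSet {w : Eucl m | ‖w‖ ≤ 1} :=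
    measurableSet_le measurable_norm measurable_const
  rw [← lintegral_add_compl _ hset, ENNReal.add_ne_top]
  constructor
  · refine (lt_of_le_of_lt (setLIntegral_mono' hset fun w (hw : ‖w‖ ≤ 1) => ?_)
      (lintegral_near_ne_top hm (β := 1 - s) (by linarith)).lt_top).ne
    apply ENNReal.ofReal_le_ofReal
    rcases eq_or_lt_of_le (norm_nonneg w) with h | h
    · rw [← h]; simp; positivity
    · rw [min_eq_right hw]
      nth_rw 2 [← Real.rpow_one ‖w‖]
      rw [← Real.rpow_add h]
      apply le_of_eq; congr 1; ring
  · have hc : {w : Eucl m | ‖w‖ ≤ 1}ᶜ = {w | 1 < ‖w‖} := by ext; simp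
    rw [hc]
    refine (lt_of_le_of_lt (setLIntegral_mono' (measurableSet_lt measurable_const measurable_norm)
      fun w (hw : 1 < ‖w‖) => ?_) (lintegral_far_ne_top (m := m) (r := m + s) (by linarith)).lt_top).ne
    apply ENNReal.ofReal_le_ofReal
    rw [min_eq_left hw.le, mul_one]

/-! ### Riesz potentials of nonnegative functions -/

/-- The unnormalised Riesz potential of an extended nonnegative function. -/
noncomputable def pot (β : ℝ) (g : Eucl m → ℝ≥0∞) (x : Eucl m) : ℝ≥0∞ :=
  ∫⁻ y, ENNReal.ofReal (‖x - y‖ ^ (-((m : ℝ) - β))) * g y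

/-- The mass of the power kernel in the unit ball. -/
noncomputable def nearMass (m : ℕ) (β : ℝ) : ℝ≥0∞ :=
  ∫⁻ w : Eucl m in {w | ‖w‖ ≤ 1}, ENNReal.ofReal (‖w‖ ^ (-((m : ℝ) - β)))

/-- The power kernel restricted to the unit ball. -/
noncomputable def nearKer (β : ℝ) : Eucl m → ℝ≥0∞ :=
  {w : Eucl m | ‖w‖ ≤ 1}.indicator fun w => ENNReal.ofReal (‖w‖ ^ (-((m : ℝ) - β)))

lemma measurable_nearKer (β : ℝ) : Measurable (nearKer β : Eucl m → ℝ≥0∞) :=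
  (Measurable.ennreal_ofReal (measurable_norm_rpow _)).indicator
    (measurableSet_le measurable_norm measurable_const)

lemma lintegral_nearKer (β : ℝ) : ∫⁻ w : Eucl m, nearKer β w = nearMass m β :=
  lintegral_indicator (measurableSet_le measurable_norm measurable_const) _

lemma ker_le_near_add_one {β : ℝ} (hβ : β ≤ m) (w : Eucl m) :
    ENNReal.ofReal (‖w‖ ^ (-((m : ℝ) - β))) ≤ nearKer β w + 1 := by
  by_cases h : ‖w‖ ≤ 1
  · rw [nearKer, indicator_of_mem (show w ∈ {w : Eucl m | ‖w‖ ≤ 1} from h)]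
    exact le_self_add
  · refine le_trans ?_ le_add_self
    rw [ENNReal.ofReal_le_one]
    exact Real.rpow_le_one_of_one_le_of_nonpos (not_le.1 h).le (by linarith)

lemma measurable_ker (β : ℝ) :
    Measurable fun w : Eucl m => ENNReal.ofReal (‖w‖ ^ (-((m : ℝ) - β))) :=
  (measurable_norm_rpow _).ennreal_ofReal

lemma measurable_pot (β : ℝ) {g : Eucl m → ℝ≥0∞} (hg : Measurable g) : Measurable (pot β g) := by
  unfold pot
  apply Measurable.lintegral_prod_right' (f := fun p : Eucl m × Eucl m =>
    ENNReal.ofReal (‖p.1 - p.2‖ ^ (-((m : ℝ) - β))) * g p.2)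
  fun_prop

lemma pot_mono (β : ℝ) {g h : Eucl m → ℝ≥0∞} (hgh : ∀ y, g y ≤ h y) (x : Eucl m) :
    pot β g x ≤ pot β h x :=
  lintegral_mono fun y => by gcongr; exact hgh y

/-- The singular part of the kernel is paired with the sup bound of `g`, the part bounded by 1 with
its integral. -/
lemma pot_le {β : ℝ} (hβ : β ≤ m) {g : Eucl m → ℝ≥0∞} (hg : Measurable g) {M : ℝ≥0∞}
    (hM : ∀ y, g y ≤ M) (x : Eucl m) : pot β g x ≤ nearMass m β * M + ∫⁻ y, g y := by
  calc pot β g x ≤ ∫⁻ y, (nearKer β (x - y) * M + g y) := by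
        refine lintegral_mono fun y => ?_
        calc _ ≤ (nearKer β (x - y) + 1) * g y := by gcongr; exact ker_le_near_add_one hβ _
          _ ≤ _ := by rw [add_mul, one_mul]; gcongr; exact hM y
    _ = _ := by
        rw [lintegral_add_right _ hg, lintegral_mul_const, 
          lintegral_sub_left_eq_self (fun w => nearKer β w) x, lintegral_nearKer]
        exact (measurable_nearKer β).comp (measurable_const.sub measurable_id)

lemma pot_const_mul (β : ℝ) {g : Eucl m → ℝ≥0∞} (hg : Measurable g) (c : ℝ≥0∞) (x : Eucl m) :
    pot β (fun y => c * g y) x = c * pot β g x := by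
  unfold pot
  rw [← lintegral_const_mul]
  · congr with y; ring
  · fun_prop

/-- Replacing the larger of the two norms by the smaller leaves a single power of exponent
`-(2m-β-s)`, integrable at infinity because `β + s < m`. This replaces the composition law for Riesz
potentials, of which only boundedness is needed. -/
lemma far_mul_far_le {β s : ℝ} (hβ : 0 < β) (hs : 0 < s) (h : β + s < m) {v w : Eucl m}
    (hv : 1 < ‖v‖) (hw : 1 < ‖w‖) :
    ‖v‖ ^ (-((m : ℝ) - β)) * ‖w‖ ^ (-((m : ℝ) - s)) ≤
      ‖v‖ ^ (-(2 * (m : ℝ) - β - s)) + ‖w‖ ^ (-(2 * (m : ℝ) - β - s)) := by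
  have hv0 : 0 < ‖v‖ := by linarith
  have hw0 : 0 < ‖w‖ := by linarith
  rcases le_total ‖v‖ ‖w‖ with hle | hle
  · calc _ ≤ ‖v‖ ^ (-((m : ℝ) - β)) * ‖v‖ ^ (-((m : ℝ) - s)) := by
          gcongr ?_ * ?_
          exact Real.rpow_le_rpow_of_nonpos hv0 hle (by linarith)
      _ = ‖v‖ ^ (-(2 * (m : ℝ) - β - s)) := by rw [← Real.rpow_add hv0]; congr 1; ring
      _ ≤ _ := le_add_of_nonneg_right (by positivity)
  · calc _ ≤ ‖w‖ ^ (-((m : ℝ) - β)) * ‖w‖ ^ (-((m : ℝ) - s)) := by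
          gcongr ?_ * ?_
          exact Real.rpow_le_rpow_of_nonpos hw0 hle (by linarith)
      _ = ‖w‖ ^ (-(2 * (m : ℝ) - β - s)) := by rw [← Real.rpow_add hw0]; congr 1; ring
      _ ≤ _ := le_add_of_nonneg_left (by positivity)

/-- The power kernel restricted to the exterior of the unit ball. -/
noncomputable def farKer (r : ℝ) : Eucl m → ℝ≥0∞ :=
  {w : Eucl m | 1 < ‖w‖}.indicator fun w => ENNReal.ofReal (‖w‖ ^ (-r))

lemma measurable_farKer (r : ℝ) : Measurable (farKer r : Eucl m → ℝ≥0∞) :=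
  (Measurable.ennreal_ofReal (measurable_norm_rpow _)).indicator
    (measurableSet_lt measurable_const measurable_norm)

lemma ker_mul_ker_le {β s : ℝ} (hβ : 0 < β) (hs : 0 < s) (h : β + s < m) (v w : Eucl m) :
    ENNReal.ofReal (‖v‖ ^ (-((m : ℝ) - β))) * ENNReal.ofReal (‖w‖ ^ (-((m : ℝ) - s))) ≤
      nearKer β v * nearKer s w + nearKer β v + nearKer s w +
        (farKer (2 * (m : ℝ) - β - s) v + farKer (2 * (m : ℝ) - β - s) w) := by
  by_cases hv : ‖v‖ ≤ 1
  · refine le_trans ?_ le_self_add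
    refine le_trans ?_ le_self_add
    have hv' : ENNReal.ofReal (‖v‖ ^ (-((m : ℝ) - β))) = nearKer β v := by
      rw [nearKer, indicator_of_mem (show v ∈ {w : Eucl m | ‖w‖ ≤ 1} from hv)]
    rw [hv']
    calc _ ≤ nearKer β v * (nearKer s w + 1) := by
          gcongr; exact ker_le_near_add_one (by linarith) w
      _ = _ := by ring
  by_cases hw : ‖w‖ ≤ 1
  · refine le_trans ?_ le_self_add
    refine le_trans ?_ le_add_self
    have hw' : ENNReal.ofReal (‖w‖ ^ (-((m : ℝ) - s))) = nearKer s w := by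
      rw [nearKer, indicator_of_mem (show w ∈ {w : Eucl m | ‖w‖ ≤ 1} from hw)]
    rw [hw']
    refine mul_le_of_le_one_left' ?_
    rw [ENNReal.ofReal_le_one]
    exact Real.rpow_le_one_of_one_le_of_nonpos (not_le.1 hv).le (by linarith)
  · refine le_trans ?_ le_add_self
    rw [farKer, indicator_of_mem (show v ∈ {w : Eucl m | 1 < ‖w‖} from not_le.1 hv),
      indicator_of_mem (show w ∈ {w : Eucl m | 1 < ‖w‖} from not_le.1 hw),
      ← ENNReal.ofReal_mul (by positivity), ← ENNReal.ofReal_add (by positivity) (by positivity)]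
    exact ENNReal.ofReal_le_ofReal (far_mul_far_le hβ hs h (not_le.1 hv) (not_le.1 hw))

/-- `I_s b` decays in general only like `|x|^(-(m-s))` and need not be integrable, so `pot_le` does
not apply to it; the two kernels are estimated together instead. -/
lemma pot_pot_bounded (hm : 1 ≤ m) {β s : ℝ} (hβ : 0 < β) (hs : 0 < s) (h : β + s < m)
    {g : Eucl m → ℝ≥0∞} (hg : Measurable g) {M : ℝ≥0∞} (hM : M ≠ ∞) (hgM : ∀ y, g y ≤ M)
    (hgi : ∫⁻ y, g y ≠ ∞) : ∃ K : ℝ≥0∞, K ≠ ∞ ∧ ∀ x, pot β (pot s g) x ≤ K := by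
  set r := 2 * (m : ℝ) - β - s with hr
  set F : ℝ≥0∞ := ∫⁻ w : Eucl m, farKer r w with hF
  set I : ℝ≥0∞ := ∫⁻ y, g y with hI
  have hFt : F ≠ ∞ := by
    rw [hF]; unfold farKer
    rw [lintegral_indicator (measurableSet_lt measurable_const measurable_norm)]
    exact lintegral_far_ne_top (by linarith)
  have hnβ : nearMass m β ≠ ∞ := lintegral_near_ne_top hm hβ
  have hns : nearMass m s ≠ ∞ := lintegral_near_ne_top hm hs
  -- The summands match the kernel splitting: near times near, each near kernel alone, and the two
  -- far kernels.
  refine ⟨nearMass m β * (nearMass m s * M) + nearMass m β * I + nearMass m s * I + (F * I + F * I),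
    by finiteness, fun x => ?_⟩
  have mn := measurable_nearKer (m := m)
  have mf := measurable_farKer (m := m) r
  have m1 : ∀ (x : Eucl m) {k : Eucl m → ℝ≥0∞}, Measurable k → Measurable fun y => k (x - y) :=
    fun x k hk => hk.comp (measurable_const.sub measurable_id)
  have m2 : ∀ (z : Eucl m) {k : Eucl m → ℝ≥0∞}, Measurable k → Measurable fun y => k (y - z) :=
    fun x k hk => hk.comp (measurable_id.sub measurable_const)
  have m3 : ∀ {k : Eucl m → ℝ≥0∞}, Measurable k →
      Measurable fun p : Eucl m × Eucl m => k (p.1 - p.2) :=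
    fun hk => hk.comp (measurable_fst.sub measurable_snd)
  have mx : ∀ {k : Eucl m → ℝ≥0∞}, Measurable k → Measurable fun p : Eucl m × Eucl m => k (x - p.1) :=
    fun hk => hk.comp (measurable_const.sub measurable_fst)
  have i1 : ∀ (k : Eucl m → ℝ≥0∞) (x : Eucl m), ∫⁻ y, k (x - y) = ∫⁻ y, k y := fun k x =>
    lintegral_sub_left_eq_self k x
  have i2 : ∀ (k : Eucl m → ℝ≥0∞) (z : Eucl m), ∫⁻ y, k (y - z) = ∫⁻ y, k y := fun k z =>
    lintegral_sub_right_eq_self k z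
  have mg : Measurable fun p : Eucl m × Eucl m => g p.2 := hg.comp measurable_snd
  have nn : ∫⁻ y, ∫⁻ z, nearKer β (x - y) * nearKer s (y - z) * g z ≤
      nearMass m β * (nearMass m s * M) := by
    calc _ ≤ ∫⁻ y, nearKer β (x - y) * (nearMass m s * M) := by
          refine lintegral_mono fun y => ?_
          simp only [mul_assoc]
          have hms : Measurable fun z => nearKer s (y - z) * g z := (m1 y (mn s)).mul hg
          rw [lintegral_const_mul _ hms]
          gcongr
          calc _ ≤ ∫⁻ z, nearKer s (y - z) * M := by gcongr with z; exact hgM z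
            _ = _ := by rw [lintegral_mul_const _ (m1 y (mn s)), i1, lintegral_nearKer]
      _ = _ := by rw [lintegral_mul_const _ (m1 x (mn β)), i1, lintegral_nearKer]
  have nI : ∀ {k : Eucl m → ℝ≥0∞}, Measurable k → ∫⁻ y, ∫⁻ z, k (x - y) * g z = (∫⁻ w, k w) * I := by
    intro k hk
    simp_rw [lintegral_const_mul _ hg]
    rw [lintegral_mul_const _ (m1 x hk), i1]
  have nI' : ∀ {k : Eucl m → ℝ≥0∞}, Measurable k → ∫⁻ y, ∫⁻ z, k (y - z) * g z = (∫⁻ w, k w) * I := by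
    intro k hk
    rw [lintegral_lintegral_swap ((m3 hk).mul mg).aemeasurable]
    have : ∀ z, ∫⁻ y, k (y - z) * g z = (∫⁻ w, k w) * g z := fun z => by
      rw [lintegral_mul_const _ (m2 z hk), i2]
    simp_rw [this]
    rw [lintegral_const_mul _ hg]
  calc pot β (pot s g) x
      = ∫⁻ y, ∫⁻ z, ENNReal.ofReal (‖x - y‖ ^ (-((m : ℝ) - β))) *
          ENNReal.ofReal (‖y - z‖ ^ (-((m : ℝ) - s))) * g z := by
        unfold pot
        congr with y
        rw [← lintegral_const_mul]
        · simp only [mul_assoc]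
        · exact (m1 y (measurable_ker s)).mul hg
    _ ≤ ∫⁻ y, ∫⁻ z, (nearKer β (x - y) * nearKer s (y - z) * g z + nearKer β (x - y) * g z +
          nearKer s (y - z) * g z + (farKer r (x - y) * g z + farKer r (y - z) * g z)) := by
        refine lintegral_mono fun y => lintegral_mono fun z => ?_
        calc _ ≤ _ := mul_le_mul_left (ker_mul_ker_le hβ hs h (x - y) (y - z)) (g z)
          _ = _ := by ring
    _ = (∫⁻ y, ∫⁻ z, nearKer β (x - y) * nearKer s (y - z) * g z) +
        (∫⁻ y, ∫⁻ z, nearKer β (x - y) * g z) + (∫⁻ y, ∫⁻ z, nearKer s (y - z) * g z) +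
        ((∫⁻ y, ∫⁻ z, farKer r (x - y) * g z) + ∫⁻ y, ∫⁻ z, farKer r (y - z) * g z) := by
        have e1 : Measurable fun p : Eucl m × Eucl m =>
          nearKer β (x - p.1) * nearKer s (p.1 - p.2) * g p.2 := ((mx (mn β)).mul (m3 (mn s))).mul mg
        have e2 : Measurable fun p : Eucl m × Eucl m => nearKer β (x - p.1) * g p.2 := (mx (mn β)).mul mg
        have e3 : Measurable fun p : Eucl m × Eucl m => nearKer s (p.1 - p.2) * g p.2 := (m3 (mn s)).mul mg
        have e4 : Measurable fun p : Eucl m × Eucl m => farKer r (x - p.1) * g p.2 := (mx mf).mul mg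
        have e5 : Measurable fun p : Eucl m × Eucl m => farKer r (p.1 - p.2) * g p.2 := (m3 mf).mul mg
        rw [← lintegral_prod _ e1.aemeasurable, ← lintegral_prod _ e2.aemeasurable,
          ← lintegral_prod _ e3.aemeasurable, ← lintegral_prod _ e4.aemeasurable,
          ← lintegral_prod _ e5.aemeasurable]
        have e45 : Measurable fun p : Eucl m × Eucl m =>
          farKer r (x - p.1) * g p.2 + farKer r (p.1 - p.2) * g p.2 := e4.add e5
        rw [← lintegral_add_left e1, ← lintegral_add_right _ e3, ← lintegral_add_left e4,
          ← lintegral_add_right _ e45]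
        exact (lintegral_prod _ (((e1.add e2).add e3).add e45).aemeasurable).symm
    _ ≤ _ := by
        rw [nI (mn β), nI' (mn s), nI mf, nI' mf, lintegral_nearKer, lintegral_nearKer]
        gcongr

end

/-! ### Function classes -/

section

variable {m : ℕ} {F : Type*} [NormedAddCommGroup F]

/-- Bounded Lipschitz functions. -/
def BddLip (f : Eucl m → F) : Prop :=
  ∃ C : ℝ, 0 ≤ C ∧ (∀ x, ‖f x‖ ≤ C) ∧ ∀ x y, ‖f x - f y‖ ≤ C * min 1 ‖x - y‖

/-- Functions which, together with their Lipschitz modulus, are dominated by `decay`. -/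
def LipDecay (f : Eucl m → F) : Prop :=
  ∃ C : ℝ, 0 ≤ C ∧ (∀ x, ‖f x‖ ≤ C * decay x) ∧
    ∀ x y, ‖f x - f y‖ ≤ C * (min 1 ‖x - y‖ * (decay x + decay y))

lemma BddLip.continuous {f : Eucl m → F} (hf : BddLip f) : Continuous f := by
  obtain ⟨C, hC, -, h⟩ := hf
  refine (LipschitzWith.of_dist_le_mul (K := ⟨C, hC⟩) fun x y => ?_).continuous
  rw [dist_eq_norm, dist_eq_norm]
  exact (h x y).trans (by gcongr; exacts [le_rfl, min_le_right _ _])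

lemma LipDecay.bddLip {f : Eucl m → F} (hf : LipDecay f) : BddLip f := by
  obtain ⟨C, hC, h1, h2⟩ := hf
  refine ⟨2 * C, by positivity, fun x => (h1 x).trans ?_, fun x y => (h2 x y).trans ?_⟩
  · nlinarith [decay_le_one x, decay_nonneg x]
  · have h0 : 0 ≤ min 1 ‖x - y‖ := le_min zero_le_one (norm_nonneg _)
    calc _ ≤ C * (min 1 ‖x - y‖ * (1 + 1)) := by gcongr <;> exact decay_le_one _
      _ = _ := by ring

lemma LipDecay.continuous {f : Eucl m → F} (hf : LipDecay f) : Continuous f := hf.bddLip.continuous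

lemma LipDecay.integrable {f : Eucl m → F} (hf : LipDecay f) : Integrable f := by
  have hc := hf.continuous
  obtain ⟨C, hC, h1, h2⟩ := hf
  exact (integrable_decay.const_mul C).mono' hc.aestronglyMeasurable (ae_of_all _ h1)

lemma BddLip.sub {f g : Eucl m → F} (hf : BddLip f) (hg : BddLip g) :
    BddLip fun x => f x - g x := by
  obtain ⟨C, hC, h1, h2⟩ := hf
  obtain ⟨D, hD, k1, k2⟩ := hg
  refine ⟨C + D, by positivity, fun x => (norm_sub_le _ _).trans (add_le_add (h1 x) (k1 x)),
    fun x y => ?_⟩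
  calc ‖f x - g x - (f y - g y)‖ = ‖(f x - f y) - (g x - g y)‖ := by congr 1; abel
    _ ≤ _ := norm_sub_le _ _
    _ ≤ _ := by rw [add_mul]; exact add_le_add (h2 x y) (k2 x y)

lemma norm_mul_sub_mul_le {𝕜 : Type*} [NormedRing 𝕜] (a b c d : 𝕜) :
    ‖a * b - c * d‖ ≤ ‖a‖ * ‖b - d‖ + ‖a - c‖ * ‖d‖ := by
  calc _ = ‖a * (b - d) + (a - c) * d‖ := by congr 1; noncomm_ring
    _ ≤ _ := (norm_add_le _ _).trans (add_le_add (norm_mul_le _ _) (norm_mul_le _ _))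

lemma BddLip.mul {𝕜 : Type*} [NormedRing 𝕜] {f g : Eucl m → 𝕜} (hf : BddLip f)
    (hg : BddLip g) : BddLip fun x => f x * g x := by
  obtain ⟨C, hC, h1, h2⟩ := hf
  obtain ⟨D, hD, k1, k2⟩ := hg
  refine ⟨2 * (C * D), by positivity, fun x => ?_, fun x y => ?_⟩
  · calc _ ≤ ‖f x‖ * ‖g x‖ := norm_mul_le _ _
      _ ≤ C * D := by gcongr; exacts [h1 x, k1 x]
      _ ≤ _ := by nlinarith [mul_nonneg hC hD]
  · have h0 : 0 ≤ min 1 ‖x - y‖ := le_min zero_le_one (norm_nonneg _)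
    calc _ ≤ ‖f x‖ * ‖g x - g y‖ + ‖f x - f y‖ * ‖g y‖ := norm_mul_sub_mul_le _ _ _ _
      _ ≤ C * (D * min 1 ‖x - y‖) + (C * min 1 ‖x - y‖) * D := by
        gcongr
        exacts [h1 x, k2 x y, h2 x y, k1 y]
      _ = _ := by ring

lemma LipDecay.mul {𝕜 : Type*} [NormedRing 𝕜] {f g : Eucl m → 𝕜} (hf : LipDecay f)
    (hg : LipDecay g) : LipDecay fun x => f x * g x := by
  obtain ⟨C, hC, h1, -⟩ := hf.bddLip
  obtain ⟨C', hC', -, h2⟩ := hf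
  obtain ⟨D, hD, k1, -⟩ := hg.bddLip
  obtain ⟨D', hD', k1', k2⟩ := hg
  refine ⟨C * D' + C' * D, by positivity, fun x => ?_, fun x y => ?_⟩
  · have h0 := decay_nonneg x
    calc _ ≤ ‖f x‖ * ‖g x‖ := norm_mul_le _ _
      _ ≤ C * (D' * decay x) := by gcongr; exacts [h1 x, k1' x]
      _ ≤ _ := by nlinarith [mul_nonneg hC' hD, mul_nonneg (mul_nonneg hC' hD) h0]
  · have h0 : 0 ≤ min 1 ‖x - y‖ * (decay x + decay y) :=
      mul_nonneg (le_min zero_le_one (norm_nonneg _)) (add_nonneg (decay_nonneg _) (decay_nonneg _))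
    calc _ ≤ ‖f x‖ * ‖g x - g y‖ + ‖f x - f y‖ * ‖g y‖ := norm_mul_sub_mul_le _ _ _ _
      _ ≤ C * (D' * (min 1 ‖x - y‖ * (decay x + decay y))) +
          (C' * (min 1 ‖x - y‖ * (decay x + decay y))) * D := by
        gcongr
        exacts [h1 x, k2 x y, h2 x y, k1 y]
      _ = _ := by ring

/-- Lets a gradient bound by `decay` on the unit ball around `x` be expressed through `decay x`
alone. -/
lemma decay_le_of_norm_sub_le {x z : Eucl m} (h : ‖x - z‖ ≤ 1) :
    decay z ≤ 2 ^ ((m : ℝ) + 1) * decay x := by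
  unfold decay
  have hx := norm_nonneg x
  have hz := norm_nonneg z
  have hle : 1 + ‖x‖ ≤ 2 * (1 + ‖z‖) := by
    have := norm_sub_norm_le x z
    linarith
  rw [Real.rpow_neg (by positivity), Real.rpow_neg (by positivity), ← div_eq_mul_inv,
    le_div_iff₀ (by positivity), inv_mul_le_iff₀ (by positivity), mul_comm,
    ← Real.mul_rpow (by norm_num) (by positivity)]
  exact Real.rpow_le_rpow (by positivity) hle (by positivity)

variable [NormedSpace ℝ F]

/-- At distance at least 1 the decay of `f` suffices; at smaller distance the mean value inequality
on the unit ball uses the decay of the derivative. -/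
lemma lipDecay_schwartz (f : 𝓢(Eucl m, F)) : LipDecay (f : Eucl m → F) := by
  have key : ∀ n : ℕ, ∃ C : ℝ, 0 ≤ C ∧ ∀ x, ‖iteratedFDeriv ℝ n f x‖ ≤ C * decay x := by
    intro n
    refine ⟨2 ^ (m + 1) * ((Finset.Iic (m + 1, n)).sup fun p => SchwartzMap.seminorm ℝ p.1 p.2) f,
      by positivity, fun x => ?_⟩
    have h := SchwartzMap.one_add_le_sup_seminorm_apply (𝕜 := ℝ) (m := (m + 1, n)) (k := m + 1)
      (n := n) le_rfl le_rfl f x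
    have hx := norm_nonneg x
    have hd : decay x = ((1 + ‖x‖) ^ (m + 1))⁻¹ := by
      unfold decay
      rw [Real.rpow_neg (by positivity), ← Real.rpow_natCast]
      push_cast; rfl
    rw [hd, ← div_eq_mul_inv, le_div_iff₀ (by positivity), mul_comm]
    exact h
  obtain ⟨C, hC, h0⟩ := key 0
  obtain ⟨D, hD, h1⟩ := key 1
  have h0' : ∀ x, ‖f x‖ ≤ C * decay x := fun x => by simpa using h0 x
  have h1' : ∀ x, ‖fderiv ℝ f x‖ ≤ D * decay x := fun x => by
    simpa [norm_iteratedFDeriv_one] using h1 x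
  have h2 : (0 : ℝ) ≤ 2 ^ ((m : ℝ) + 1) := by positivity
  refine ⟨C + D * 2 ^ ((m : ℝ) + 1), by positivity, fun x => ?_, fun x y => ?_⟩
  · refine (h0' x).trans ?_
    have := decay_nonneg x
    gcongr
    exact le_add_of_nonneg_right (by positivity)
  · have hx := decay_nonneg x
    have hy := decay_nonneg y
    rcases le_total 1 ‖x - y‖ with h | h
    · rw [min_eq_left h, one_mul]
      calc _ ≤ ‖f x‖ + ‖f y‖ := norm_sub_le _ _
        _ ≤ C * decay x + C * decay y := add_le_add (h0' x) (h0' y)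
        _ = C * (decay x + decay y) := by ring
        _ ≤ _ := by gcongr; exact le_add_of_nonneg_right (by positivity)
    · rw [min_eq_right h]
      have hb : ∀ z ∈ Metric.closedBall x 1, ‖fderiv ℝ f z‖ ≤ D * (2 ^ ((m : ℝ) + 1) * decay x) := by
        intro z hz
        refine (h1' z).trans ?_
        gcongr
        apply decay_le_of_norm_sub_le
        rw [← dist_eq_norm, dist_comm]; exact hz
      have := (convex_closedBall x 1).norm_image_sub_le_of_norm_fderiv_le
        (𝕜 := ℝ) (fun z _ => f.differentiableAt) hb
        (show y ∈ Metric.closedBall x 1 by rwa [Metric.mem_closedBall, dist_comm, dist_eq_norm])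
        (show x ∈ Metric.closedBall x 1 by simp)
      refine this.trans ?_
      calc _ = D * 2 ^ ((m : ℝ) + 1) * (‖x - y‖ * decay x) := by ring
        _ ≤ _ := by
          gcongr
          · exact le_add_of_nonneg_left hC
          · exact le_add_of_nonneg_right hy

/-! ### The hypersingular integral of bounded Lipschitz functions -/

/-- The unnormalised fractional Laplacian. -/
noncomputable def hyper (s : ℝ) (f : Eucl m → F) (x : Eucl m) : F :=
  ∫ w, ‖w‖ ^ (-((m : ℝ) + s)) • (f x - f (x + w))

/-- The unnormalised Riesz potential. -/
noncomputable def riesz (s : ℝ) (f : Eucl m → F) (x : Eucl m) : F :=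
  ∫ z, ‖z‖ ^ (-((m : ℝ) - s)) • f (x + z)

lemma rieszPotential_eq (s : ℝ) (f : Eucl m → F) (x : Eucl m) :
    rieszPotential s f x = rieszPotentialConst m s • riesz s f x := by
  unfold rieszPotential riesz
  congr 1
  rw [← integral_add_left_eq_self _ x]
  congr with z
  rw [sub_add_cancel_left, norm_neg]

lemma hyper_eq (s : ℝ) (f : Eucl m → F) (x : Eucl m) :
    hyper s f x = ∫ y, fracLaplacianIntegrand s f x y := by
  unfold hyper
  rw [← integral_add_left_eq_self (fun y => fracLaplacianIntegrand s f x y) x]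
  congr with z
  rw [fracLaplacianIntegrand, sub_add_cancel_left, norm_neg]

lemma integrable_levy (hm : 1 ≤ m) {s : ℝ} (hs : 0 < s) (hs1 : s < 1) :
    Integrable fun w : Eucl m => ‖w‖ ^ (-((m : ℝ) + s)) * min 1 ‖w‖ := by
  refine ⟨(by fun_prop : Measurable _).aestronglyMeasurable, ?_⟩
  rw [hasFiniteIntegral_iff_ofReal]
  · exact (lintegral_levy_ne_top hm hs hs1).lt_top
  · exact ae_of_all _ fun w => mul_nonneg (by positivity) (le_min zero_le_one (norm_nonneg _))

lemma BddLip.integrable_hyper (hm : 1 ≤ m) {s : ℝ} (hs : 0 < s) (hs1 : s < 1) {f : Eucl m → F}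
    (hf : BddLip f) (x : Eucl m) :
    Integrable fun w => ‖w‖ ^ (-((m : ℝ) + s)) • (f x - f (x + w)) := by
  have hc := hf.continuous
  obtain ⟨C, hC, h1, h2⟩ := hf
  refine ((integrable_levy hm hs hs1).const_mul C).mono' ?_ (ae_of_all _ fun w => ?_)
  · exact (measurable_norm_rpow _).aestronglyMeasurable.smul (by fun_prop)
  · rw [norm_smul, Real.norm_of_nonneg (by positivity)]
    have := h2 x (x + w)
    rw [sub_add_cancel_left, norm_neg] at this
    calc _ ≤ ‖w‖ ^ (-((m : ℝ) + s)) * (C * min 1 ‖w‖) := by gcongr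
      _ = _ := by ring

lemma BddLip.integrable_fracLaplacianIntegrand (hm : 1 ≤ m) {s : ℝ} (hs : 0 < s) (hs1 : s < 1)
    {f : Eucl m → F} (hf : BddLip f) (x : Eucl m) :
    Integrable (fracLaplacianIntegrand s f x) := by
  have h := (hf.integrable_hyper hm hs hs1 x).comp_add_left (-x)
  refine h.congr (ae_of_all _ fun y => ?_)
  rw [fracLaplacianIntegrand]
  simp only [add_neg_cancel_left]
  rw [norm_sub_rev x y, neg_add_eq_sub]

/-- The truncation domains exhaust everything but the null set `{x}`, so for an integrable integrand
the truncated integrals converge to the full one. -/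
lemma aecover_norm_sub (hm : 1 ≤ m) (x : Eucl m) :
    AECover (volume : Measure (Eucl m)) (𝓝[>] (0 : ℝ)) fun ε => {y | ε < ‖x - y‖} := by
  have := nontrivial_eucl hm
  refine ⟨?_, fun ε => measurableSet_lt measurable_const (by fun_prop)⟩
  have : ∀ᵐ y : Eucl m, y ≠ x := by simp [ae_iff]
  filter_upwards [this] with y hy
  have h0 : 0 < ‖x - y‖ := norm_pos_iff.2 (sub_ne_zero.2 hy.symm)
  exact mem_nhdsWithin_of_mem_nhds (Iio_mem_nhds h0)

lemma tendsto_truncFracLaplacian (hm : 1 ≤ m) {s : ℝ} {f : Eucl m → F} {x : Eucl m}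
    (h : Integrable (fracLaplacianIntegrand s f x)) :
    Tendsto (truncFracLaplacian s f x) (𝓝[>] 0) (𝓝 (fracLaplacianConst m s • hyper s f x)) := by
  rw [hyper_eq]
  exact ((aecover_norm_sub hm x).integral_tendsto_of_countably_generated h).const_smul _

lemma fracLaplacian_eq (hm : 1 ≤ m) {s : ℝ} {f : Eucl m → F} {x : Eucl m}
    (h : Integrable (fracLaplacianIntegrand s f x)) :
    fracLaplacian s f x = fracLaplacianConst m s • hyper s f x := by
  unfold fracLaplacian
  exact (tendsto_truncFracLaplacian hm h).limUnder_eq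

lemma fracLaplacianExists (hm : 1 ≤ m) {s : ℝ} {f : Eucl m → F} {x : Eucl m}
    (h : Integrable (fracLaplacianIntegrand s f x)) : FracLaplacianExists s f x :=
  ⟨fun _ _ => h.integrableOn, _, tendsto_truncFracLaplacian hm h⟩

lemma BddLip.fracLaplacian_eq (hm : 1 ≤ m) {s : ℝ} (hs : 0 < s) (hs1 : s < 1) {f : Eucl m → F}
    (hf : BddLip f) : fracLaplacian s f = fun x => fracLaplacianConst m s • hyper s f x :=
  funext fun x => FracComm.fracLaplacian_eq hm (hf.integrable_fracLaplacianIntegrand hm hs hs1 x)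

/-! ### Fubini for the composition of the two operators -/

/-- One domination serves two exchanges of integrals: `k = 1` for the Fourier transform of `hyper s
f`, and `k` the Riesz kernel for commuting the two operators. The `decay` factors of the Lipschitz
modulus provide integrability in `z`, the weight `min 1 ‖w‖` integrability in `w`. -/
lemma LipDecay.integrable_prod (hm : 1 ≤ m) {s : ℝ} (hs : 0 < s) (hs1 : s < 1) {f : Eucl m → F}
    (hf : LipDecay f) {k : Eucl m → ℝ} (hk : Measurable k) (hk0 : ∀ z, 0 ≤ k z) {B : ℝ≥0∞}
    (hB : B ≠ ∞) (hkB : ∀ x, ∫⁻ z, ENNReal.ofReal (k z) * ENNReal.ofReal (decay (x + z)) ≤ B)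
    (x : Eucl m) :
    Integrable (fun p : Eucl m × Eucl m =>
      k p.1 • ‖p.2‖ ^ (-((m : ℝ) + s)) • (f (x + p.1) - f (x + p.1 + p.2)))
      (volume.prod volume) := by
  have hc := hf.continuous
  obtain ⟨C, hC, -, h2⟩ := hf
  have hcd := continuous_decay (m := m)
  have hmeas : AEStronglyMeasurable (fun p : Eucl m × Eucl m =>
      k p.1 • ‖p.2‖ ^ (-((m : ℝ) + s)) • (f (x + p.1) - f (x + p.1 + p.2)))
      (volume.prod volume) := by
    refine (hk.comp measurable_fst).aestronglyMeasurable.smul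
      (((measurable_norm_rpow _).comp measurable_snd).aestronglyMeasurable.smul ?_)
    exact Continuous.aestronglyMeasurable (by fun_prop)
  have hL := lintegral_levy_ne_top hm hs hs1
  set L := fun w : Eucl m => ENNReal.ofReal (‖w‖ ^ (-((m : ℝ) + s)) * min 1 ‖w‖) with hLdef
  have mL : Measurable L := by fun_prop
  have mk : Measurable fun z => ENNReal.ofReal (k z) := hk.ennreal_ofReal
  have md : Measurable fun z : Eucl m => ENNReal.ofReal (decay z) :=
    hcd.measurable.ennreal_ofReal
  refine ⟨hmeas, ?_⟩
  rw [HasFiniteIntegral]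
  -- The second `decay` is written with base point `x + p.2`, so that `hkB` applies at the
  -- translated point with the same `B`.
  have hle : ∀ p : Eucl m × Eucl m,
      ‖k p.1 • ‖p.2‖ ^ (-((m : ℝ) + s)) • (f (x + p.1) - f (x + p.1 + p.2))‖ₑ ≤
        ENNReal.ofReal C * L p.2 * (ENNReal.ofReal (k p.1) * ENNReal.ofReal (decay (x + p.1)) +
          ENNReal.ofReal (k p.1) * ENNReal.ofReal (decay (x + p.2 + p.1))) := by
    rintro ⟨z, w⟩
    have hmin : 0 ≤ min 1 ‖w‖ := le_min zero_le_one (norm_nonneg _)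
    have d1 := decay_nonneg (x + z)
    have d2 := decay_nonneg (x + w + z)
    have hkz := hk0 z
    simp only
    rw [← ofReal_norm, ← ENNReal.ofReal_mul hkz, ← ENNReal.ofReal_mul hkz,
      ← ENNReal.ofReal_add (by positivity) (by positivity), hLdef, ← ENNReal.ofReal_mul hC,
      ← ENNReal.ofReal_mul (by positivity)]
    apply ENNReal.ofReal_le_ofReal
    rw [norm_smul, norm_smul, Real.norm_of_nonneg hkz, Real.norm_of_nonneg (by positivity)]
    have := h2 (x + z) (x + z + w)
    rw [sub_add_cancel_left, norm_neg, add_right_comm x z w] at this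
    rw [add_right_comm x z w]
    calc _ ≤ k z * (‖w‖ ^ (-((m : ℝ) + s)) *
          (C * (min 1 ‖w‖ * (decay (x + z) + decay (x + w + z))))) := by gcongr
      _ = _ := by ring
  refine lt_of_le_of_lt (lintegral_mono hle) ?_
  have mm : Measurable fun p : Eucl m × Eucl m =>
      ENNReal.ofReal C * L p.2 * (ENNReal.ofReal (k p.1) * ENNReal.ofReal (decay (x + p.1)) +
          ENNReal.ofReal (k p.1) * ENNReal.ofReal (decay (x + p.2 + p.1))) := by
    fun_prop
  rw [lintegral_prod_symm _ mm.aemeasurable]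
  calc _ ≤ ∫⁻ w, ENNReal.ofReal C * L w * (B + B) := by
        refine lintegral_mono fun w => ?_
        simp only
        rw [lintegral_const_mul _ (by fun_prop), lintegral_add_left (by fun_prop)]
        gcongr
        exacts [hkB x, hkB (x + w)]
    _ = ENNReal.ofReal C * (∫⁻ w, L w) * (B + B) := by
        rw [lintegral_mul_const _ (by fun_prop), lintegral_const_mul _ mL]
    _ < ∞ := by
        have : ∫⁻ w, L w ≠ ∞ := hL
        exact (by finiteness : _ ≠ ∞).lt_top

lemma lintegral_decay_add (x : Eucl m) :
    ∫⁻ z, ENNReal.ofReal 1 * ENNReal.ofReal (decay (x + z)) =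
      ∫⁻ z : Eucl m, ENNReal.ofReal (decay z) := by
  simp only [ENNReal.ofReal_one, one_mul]
  exact lintegral_add_left_eq_self (fun z : Eucl m => ENNReal.ofReal (decay z)) x

lemma LipDecay.integrable_prod_hyper (hm : 1 ≤ m) {s : ℝ} (hs : 0 < s) (hs1 : s < 1)
    {f : Eucl m → F} (hf : LipDecay f) :
    Integrable (fun p : Eucl m × Eucl m => ‖p.2‖ ^ (-((m : ℝ) + s)) • (f p.1 - f (p.1 + p.2)))
      (volume.prod volume) := by
  have := hf.integrable_prod hm hs hs1 (k := fun _ => 1) measurable_const (fun _ => zero_le_one)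
    lintegral_decay_ne_top (fun x => (lintegral_decay_add x).le) 0
  simpa using this

lemma LipDecay.integrable_hyper' (hm : 1 ≤ m) {s : ℝ} (hs : 0 < s) (hs1 : s < 1)
    {f : Eucl m → F} (hf : LipDecay f) : Integrable (hyper s f) :=
  (hf.integrable_prod_hyper hm hs hs1).integral_prod_left

lemma BddLip.hyper_bounded (hm : 1 ≤ m) {s : ℝ} (hs : 0 < s) (hs1 : s < 1)
    {f : Eucl m → F} (hf : BddLip f) : ∃ C : ℝ, ∀ x, ‖hyper s f x‖ ≤ C := by
  obtain ⟨C, hC, h1, h2⟩ := hf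
  refine ⟨∫ w : Eucl m, C * (‖w‖ ^ (-((m : ℝ) + s)) * min 1 ‖w‖), fun x => ?_⟩
  refine norm_integral_le_of_norm_le ((integrable_levy hm hs hs1).const_mul C)
    (ae_of_all _ fun w => ?_)
  rw [norm_smul, Real.norm_of_nonneg (by positivity)]
  have := h2 x (x + w)
  rw [sub_add_cancel_left, norm_neg] at this
  calc _ ≤ ‖w‖ ^ (-((m : ℝ) + s)) * (C * min 1 ‖w‖) := by gcongr
    _ = _ := by ring

lemma stronglyMeasurable_hyper (s : ℝ) {f : Eucl m → F} (hf : Continuous f) :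
    StronglyMeasurable (hyper s f) := by
  have : StronglyMeasurable fun p : Eucl m × Eucl m =>
      ‖p.2‖ ^ (-((m : ℝ) + s)) • (f p.1 - f (p.1 + p.2)) := by
    refine StronglyMeasurable.smul ?_ ?_
    · exact ((measurable_norm_rpow _).comp measurable_snd).stronglyMeasurable
    · exact Continuous.stronglyMeasurable (by fun_prop)
  exact this.integral_prod_right'

/-! ### Uniform bounds for Riesz potentials of decaying functions -/

lemma pot_decay_eq (s : ℝ) (x : Eucl m) :
    ∫⁻ z, ENNReal.ofReal (‖z‖ ^ (-((m : ℝ) - s))) * ENNReal.ofReal (decay (x + z)) =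
      pot s (fun y => ENNReal.ofReal (decay y)) x := by
  unfold pot
  rw [← lintegral_add_left_eq_self (fun y => ENNReal.ofReal (‖x - y‖ ^ (-((m : ℝ) - s))) *
    ENNReal.ofReal (decay y)) x]
  congr with z
  rw [sub_add_cancel_left, norm_neg]

lemma pot_decay_le (hm : 1 ≤ m) {s : ℝ} (hs : 0 < s) (hsm : s ≤ m) :
    ∃ B : ℝ≥0∞, B ≠ ∞ ∧ ∀ x : Eucl m,
      ∫⁻ z, ENNReal.ofReal (‖z‖ ^ (-((m : ℝ) - s))) * ENNReal.ofReal (decay (x + z)) ≤ B := by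
  refine ⟨nearMass m s * 1 + ∫⁻ y : Eucl m, ENNReal.ofReal (decay y), ?_, fun x => ?_⟩
  · have h1 : nearMass m s ≠ ∞ := lintegral_near_ne_top hm hs
    have h2 := lintegral_decay_ne_top (m := m)
    finiteness
  · rw [pot_decay_eq]
    exact pot_le hsm continuous_decay.measurable.ennreal_ofReal
      (fun y => ENNReal.ofReal_le_one.2 (decay_le_one y)) x

lemma integrable_ker_decay (hm : 1 ≤ m) {s : ℝ} (hs : 0 < s) (hsm : s ≤ m) (x : Eucl m) :
    Integrable fun z => ‖z‖ ^ (-((m : ℝ) - s)) * decay (x + z) := by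
  have := continuous_decay (m := m)
  refine ⟨Measurable.aestronglyMeasurable ?_, ?_⟩
  · exact (measurable_norm_rpow _).mul (by fun_prop)
  rw [hasFiniteIntegral_iff_ofReal (ae_of_all _ fun z =>
    mul_nonneg (by positivity) (decay_nonneg _))]
  obtain ⟨B, hB, h⟩ := pot_decay_le hm hs hsm
  refine lt_of_le_of_lt ?_ hB.lt_top
  refine le_trans (lintegral_mono fun z => ?_) (h x)
  rw [← ENNReal.ofReal_mul (by positivity)]

lemma integral_ker_decay_le (hm : 1 ≤ m) {s : ℝ} (hs : 0 < s) (hsm : s ≤ m) :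
    ∃ B : ℝ, 0 ≤ B ∧ ∀ x : Eucl m, ∫ z, ‖z‖ ^ (-((m : ℝ) - s)) * decay (x + z) ≤ B := by
  obtain ⟨B, hB, h⟩ := pot_decay_le hm hs hsm
  refine ⟨B.toReal, ENNReal.toReal_nonneg, fun x => ?_⟩
  have h0 : ∀ z : Eucl m, 0 ≤ ‖z‖ ^ (-((m : ℝ) - s)) * decay (x + z) := fun z =>
    mul_nonneg (by positivity) (decay_nonneg _)
  rw [integral_eq_lintegral_of_nonneg_ae (ae_of_all _ h0)
    (integrable_ker_decay hm hs hsm x).aestronglyMeasurable]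
  refine ENNReal.toReal_mono hB (le_trans (lintegral_mono fun z => ?_) (h x))
  rw [← ENNReal.ofReal_mul (by positivity)]

lemma LipDecay.integrable_riesz (hm : 1 ≤ m) {s : ℝ} (hs : 0 < s) (hsm : s ≤ m) {f : Eucl m → F}
    (hf : LipDecay f) (x : Eucl m) : Integrable fun z => ‖z‖ ^ (-((m : ℝ) - s)) • f (x + z) := by
  have hc := hf.continuous
  obtain ⟨C, hC, h1, -⟩ := hf
  refine ((integrable_ker_decay hm hs hsm x).const_mul C).mono'
    ((measurable_norm_rpow _).aestronglyMeasurable.smul (by fun_prop)) (ae_of_all _ fun z => ?_)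
  rw [norm_smul, Real.norm_of_nonneg (by positivity)]
  calc _ ≤ ‖z‖ ^ (-((m : ℝ) - s)) * (C * decay (x + z)) := by gcongr; exact h1 _
    _ = _ := by ring

/-- Differences of the potential are potentials of differences, and the integral of the kernel
against `decay (x + ·)` is bounded uniformly in `x`. -/
lemma LipDecay.bddLip_riesz (hm : 1 ≤ m) {s : ℝ} (hs : 0 < s) (hsm : s ≤ m) {f : Eucl m → F}
    (hf : LipDecay f) : BddLip (riesz s f) := by
  have hi := hf.integrable_riesz hm hs hsm
  obtain ⟨C, hC, h1, h2⟩ := hf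
  obtain ⟨B, hB, hBle⟩ := integral_ker_decay_le hm hs hsm
  have hd := integrable_ker_decay hm hs hsm
  refine ⟨2 * (C * B), by positivity, fun x => ?_, fun x y => ?_⟩
  · calc ‖riesz s f x‖ ≤ ∫ z, C * (‖z‖ ^ (-((m : ℝ) - s)) * decay (x + z)) := by
          refine norm_integral_le_of_norm_le ((hd x).const_mul C) (ae_of_all _ fun z => ?_)
          rw [norm_smul, Real.norm_of_nonneg (by positivity)]
          calc _ ≤ ‖z‖ ^ (-((m : ℝ) - s)) * (C * decay (x + z)) := by gcongr; exact h1 _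
            _ = _ := by ring
      _ ≤ C * B := by rw [integral_const_mul]; gcongr; exact hBle x
      _ ≤ _ := by nlinarith [mul_nonneg hC hB]
  · have hmin : 0 ≤ min 1 ‖x - y‖ := le_min zero_le_one (norm_nonneg _)
    unfold riesz
    rw [← integral_sub (hi x) (hi y)]
    calc _ ≤ ∫ z, C * min 1 ‖x - y‖ * (‖z‖ ^ (-((m : ℝ) - s)) * decay (x + z) +
            ‖z‖ ^ (-((m : ℝ) - s)) * decay (y + z)) := by
          refine norm_integral_le_of_norm_le (((hd x).add (hd y)).const_mul _)
            (ae_of_all _ fun z => ?_)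
          rw [← smul_sub, norm_smul, Real.norm_of_nonneg (by positivity)]
          have := h2 (x + z) (y + z)
          rw [add_sub_add_right_eq_sub] at this
          calc _ ≤ ‖z‖ ^ (-((m : ℝ) - s)) *
                (C * (min 1 ‖x - y‖ * (decay (x + z) + decay (y + z)))) := by gcongr
            _ = _ := by ring
      _ ≤ C * min 1 ‖x - y‖ * (B + B) := by
          rw [integral_const_mul, integral_add (hd x) (hd y)]
          gcongr
          exacts [hBle x, hBle y]
      _ = _ := by ring

/-- Both operators are superpositions of translations, hence commute by Fubini. One inversion
identity therefore serves both orders of composition. -/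
lemma LipDecay.hyper_riesz (hm : 1 ≤ m) {s : ℝ} (hs : 0 < s) (hs1 : s < 1) {f : Eucl m → F}
    (hf : LipDecay f) (x : Eucl m) : hyper s (riesz s f) x = riesz s (hyper s f) x := by
  have hsm : s ≤ m := hs1.le.trans (by exact_mod_cast hm)
  have hi := hf.integrable_riesz hm hs hsm
  obtain ⟨B, hB, hBle⟩ := pot_decay_le hm hs hsm
  have key := hf.integrable_prod hm hs hs1 (k := fun z => ‖z‖ ^ (-((m : ℝ) - s)))
    (measurable_norm_rpow _) (fun _ => by positivity) hB hBle x
  calc hyper s (riesz s f) x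
      = ∫ w, ∫ z, ‖z‖ ^ (-((m : ℝ) - s)) • ‖w‖ ^ (-((m : ℝ) + s)) •
          (f (x + z) - f (x + z + w)) := by
        unfold hyper riesz
        congr with w
        rw [← integral_sub (hi x) (hi (x + w)), ← integral_smul]
        congr with z
        rw [← smul_sub, smul_comm, add_right_comm x w z]
    _ = ∫ z, ∫ w, ‖z‖ ^ (-((m : ℝ) - s)) • ‖w‖ ^ (-((m : ℝ) + s)) •
          (f (x + z) - f (x + z + w)) := (integral_integral_swap key).symm
    _ = _ := by
        unfold hyper riesz
        simp_rw [integral_smul]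

end

/-! ### The Fourier symbol of the fractional Laplacian -/

section

variable {m : ℕ}

/-- The character `w ↦ exp (2 π i ⟪w, ξ⟫)`. -/
noncomputable def wave (ξ w : Eucl m) : ℂ :=
  Complex.exp (Complex.I * ((2 * Real.pi * inner ℝ w ξ : ℝ) : ℂ))

lemma norm_wave (ξ w : Eucl m) : ‖wave ξ w‖ = 1 := Complex.norm_exp_I_mul_ofReal _

lemma wave_add (ξ v w : Eucl m) : wave ξ (v + w) = wave ξ v * wave ξ w := by
  unfold wave
  rw [← Complex.exp_add, inner_add_left]
  congr 1; push_cast; ring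

lemma wave_zero (ξ : Eucl m) : wave ξ 0 = 1 := by simp [wave]

lemma conj_wave (ξ w : Eucl m) : (starRingEnd ℂ) (wave ξ w) = wave ξ (-w) := by
  unfold wave
  rw [← Complex.exp_conj]
  rw [map_mul, Complex.conj_I, Complex.conj_ofReal, inner_neg_left]
  congr 1; push_cast; ring

lemma continuous_wave_uncurry : Continuous fun p : Eucl m × Eucl m => wave p.1 p.2 := by
  unfold wave; fun_prop

lemma bddLip_wave (ξ : Eucl m) : BddLip (wave ξ) := by
  refine ⟨2 + 2 * Real.pi * ‖ξ‖, by positivity, fun x => ?_, fun x y => ?_⟩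
  · rw [norm_wave]
    have : 0 ≤ 2 * Real.pi * ‖ξ‖ := by positivity
    linarith
  · have h1 : ‖wave ξ x - wave ξ y‖ ≤ 2 := by
      calc _ ≤ _ := norm_sub_le _ _
        _ = 2 := by rw [norm_wave, norm_wave]; norm_num
    have h2 : ‖wave ξ x - wave ξ y‖ ≤ 2 * Real.pi * ‖ξ‖ * ‖x - y‖ := by
      have : wave ξ x - wave ξ y = (wave ξ (x - y) - 1) * wave ξ y := by
        rw [sub_mul, ← wave_add, sub_add_cancel, one_mul]
      rw [this, norm_mul, norm_wave, mul_one]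
      refine (Real.norm_exp_I_mul_ofReal_sub_one_le).trans ?_
      rw [norm_mul, Real.norm_of_nonneg (by positivity : (0 : ℝ) ≤ 2 * Real.pi),
        mul_assoc (2 * Real.pi)]
      exact mul_le_mul_of_nonneg_left
        ((norm_inner_le_norm (𝕜 := ℝ) (x - y) ξ).trans_eq (mul_comm _ _)) (by positivity)
    have hpos : 0 ≤ 2 * Real.pi * ‖ξ‖ := by positivity
    rcases le_total 1 ‖x - y‖ with h | h
    · rw [min_eq_left h]; linarith
    · rw [min_eq_right h]
      nlinarith [norm_nonneg (x - y)]

/-- The Fourier symbol of `hyper s`. -/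
noncomputable def symb (s : ℝ) (ξ : Eucl m) : ℂ := hyper s (wave ξ) 0

/-- Translation by `w` becomes multiplication by `wave ξ w`, so after Fubini the transform of `f`
factors out and the remaining integral is `hyper s (wave ξ) 0`. -/
lemma fourier_hyper (hm : 1 ≤ m) {s : ℝ} (hs : 0 < s) (hs1 : s < 1) {f : Eucl m → ℂ}
    (hf : LipDecay f) (ξ : Eucl m) : 𝓕 (hyper s f) ξ = symb s ξ * 𝓕 f ξ := by
  have hFT : ∀ g : Eucl m → ℂ, 𝓕 g ξ = ∫ v, wave ξ (-v) * g v := by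
    intro g
    rw [Real.fourier_eq']
    congr with v
    rw [smul_eq_mul, wave, inner_neg_left]
    congr 2; push_cast; ring
  have hcw : Continuous (wave ξ) := (bddLip_wave ξ).continuous
  have hint : ∀ g : Eucl m → ℂ, Integrable g → Integrable fun v => wave ξ (-v) * g v := by
    intro g hg
    exact hg.bdd_mul (c := 1) (by fun_prop) (ae_of_all _ fun v => (norm_wave _ _).le)
  have key : Integrable (fun p : Eucl m × Eucl m => wave ξ (-p.1) *
      ‖p.2‖ ^ (-((m : ℝ) + s)) • (f p.1 - f (p.1 + p.2))) (volume.prod volume) :=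
    (hf.integrable_prod_hyper hm hs hs1).bdd_mul (c := 1)
      (by fun_prop) (ae_of_all _ fun p => (norm_wave _ _).le)
  have htr : ∀ w, ∫ v, wave ξ (-v) * f (v + w) = wave ξ w * 𝓕 f ξ := by
    intro w
    rw [hFT, ← integral_const_mul, ← integral_add_right_eq_self (fun v => wave ξ w * (wave ξ (-v) * f v)) w]
    congr with v
    rw [← mul_assoc, ← wave_add]
    congr 2; abel
  have hfi := hf.integrable
  calc 𝓕 (hyper s f) ξ
      = ∫ v, ∫ w, wave ξ (-v) * ‖w‖ ^ (-((m : ℝ) + s)) • (f v - f (v + w)) := by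
        rw [hFT]
        unfold hyper
        simp_rw [integral_const_mul]
    _ = ∫ w, ∫ v, wave ξ (-v) * ‖w‖ ^ (-((m : ℝ) + s)) • (f v - f (v + w)) :=
        integral_integral_swap key
    _ = ∫ w, (‖w‖ ^ (-((m : ℝ) + s)) • (wave ξ 0 - wave ξ (0 + w))) * 𝓕 f ξ := by
        congr with w
        have : ∀ v, wave ξ (-v) * ‖w‖ ^ (-((m : ℝ) + s)) • (f v - f (v + w)) =
            ‖w‖ ^ (-((m : ℝ) + s)) • (wave ξ (-v) * f v - wave ξ (-v) * f (v + w)) := fun v => by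
          rw [mul_smul_comm, mul_sub]
        simp_rw [this]
        rw [integral_smul, integral_sub (hint f hfi) (hint _ (hfi.comp_add_right w)), htr, ← hFT,
          wave_zero, zero_add, smul_mul_assoc, sub_mul, one_mul]
    _ = _ := by rw [integral_mul_const]; rfl

section

variable {F : Type*} [NormedAddCommGroup F] [NormedSpace ℝ F]

/-- Substituting `c • w` contributes `c^(m+s)` from the kernel and `c^(-m)` from the volume. -/
lemma hyper_comp_smul {s : ℝ} (f : Eucl m → F) {c : ℝ} (hc : 0 < c) :
    hyper s (fun w => f (c • w)) 0 = c ^ s • hyper s f 0 := by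
  unfold hyper
  have h := Measure.integral_comp_smul_of_nonneg (volume : Measure (Eucl m))
    (fun w => ‖w‖ ^ (-((m : ℝ) + s)) • (f 0 - f (0 + w))) c (hR := hc.le)
  have h2 : (∫ w : Eucl m, ‖w‖ ^ (-((m : ℝ) + s)) • (f 0 - f (0 + w))) =
      c ^ m • ∫ w : Eucl m, ‖c • w‖ ^ (-((m : ℝ) + s)) • (f 0 - f (0 + c • w)) := by
    rw [h, smul_smul]
    simp [hc.ne']
  rw [h2, smul_smul, ← integral_smul]
  congr with w
  simp only [smul_zero, zero_add]
  rw [smul_smul, norm_smul, Real.norm_of_nonneg hc.le, Real.mul_rpow hc.le (norm_nonneg _),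
    ← mul_assoc, ← Real.rpow_natCast, ← Real.rpow_add hc, ← Real.rpow_add hc]
  rw [show s + (m : ℝ) + -((m : ℝ) + s) = 0 by ring, Real.rpow_zero, one_mul]

lemma hyper_comp_isometry {s : ℝ} (f : Eucl m → F) (U : Eucl m ≃ₗᵢ[ℝ] Eucl m) :
    hyper s (fun w => f (U w)) 0 = hyper s f 0 := by
  unfold hyper
  rw [← U.measurePreserving.integral_comp U.toHomeomorph.measurableEmbedding
    (fun w => ‖w‖ ^ (-((m : ℝ) + s)) • (f 0 - f (0 + w)))]
  simp

end

lemma symb_eq {s : ℝ} (hs : 0 < s) {e : Eucl m} (he : ‖e‖ = 1) (ξ : Eucl m) :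
    symb s ξ = (‖ξ‖ ^ s : ℝ) • symb s e := by
  rcases eq_or_ne ξ 0 with rfl | hξ
  · rw [norm_zero, Real.zero_rpow hs.ne', zero_smul]
    simp [symb, hyper, wave]
  have hξ' : 0 < ‖ξ‖ := norm_pos_iff.2 hξ
  -- The reflection exchanging `ξ` and `‖ξ‖ • e`, two vectors of equal length, reduces any frequency
  -- to a multiple of `e`.
  set U := Submodule.reflection (ℝ ∙ (ξ - ‖ξ‖ • e))ᗮ with hU
  have hUξ : U ξ = ‖ξ‖ • e := by
    apply Submodule.reflection_sub
    rw [norm_smul, he, norm_norm, mul_one]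
  have hw : wave ξ = fun w => wave e (‖ξ‖ • U w) := by
    ext w
    have : inner ℝ w ξ = ‖ξ‖ * inner ℝ (U w) e := by
      rw [← U.inner_map_map w ξ, hUξ, real_inner_smul_right]
    rw [wave, wave, real_inner_smul_left, this]
  unfold symb
  rw [hw, hyper_comp_isometry (fun w => wave e (‖ξ‖ • w)) U, hyper_comp_smul _ hξ']

/-- The symbol is real because `w ↦ -w` conjugates it, and its real part integrates `1 - cos`
against a positive kernel. -/
lemma symb_pos (hm : 1 ≤ m) {s : ℝ} (hs : 0 < s) (hs1 : s < 1) {e : Eucl m} (he : ‖e‖ = 1) :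
    ∃ κ : ℝ, 0 < κ ∧ symb s e = κ := by
  have hint := (bddLip_wave e).integrable_hyper hm hs hs1 0
  have hre : (symb s e).re =
      ∫ w : Eucl m, ‖w‖ ^ (-((m : ℝ) + s)) * (1 - Real.cos (2 * Real.pi * inner ℝ w e)) := by
    unfold symb hyper
    rw [← Complex.reCLM_apply, ← ContinuousLinearMap.integral_comp_comm _ hint]
    congr with w
    rw [Complex.reCLM_apply, Complex.smul_re, Complex.sub_re, wave_zero, Complex.one_re, zero_add,
      smul_eq_mul, wave, mul_comm Complex.I, Complex.exp_ofReal_mul_I_re]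
  have hint2 : Integrable fun w : Eucl m =>
      ‖w‖ ^ (-((m : ℝ) + s)) * (1 - Real.cos (2 * Real.pi * inner ℝ w e)) := by
    refine hint.re.congr (ae_of_all _ fun w => ?_)
    change Complex.re (‖w‖ ^ (-((m : ℝ) + s)) • (wave e 0 - wave e (0 + w))) = _
    rw [Complex.smul_re, Complex.sub_re, wave_zero, Complex.one_re,
      zero_add, smul_eq_mul, wave, mul_comm Complex.I, Complex.exp_ofReal_mul_I_re]
  refine ⟨(symb s e).re, ?_, ?_⟩
  · rw [hre, integral_pos_iff_support_of_nonneg _ hint2]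
    · have hopen : IsOpen {w : Eucl m | Real.cos (2 * Real.pi * inner ℝ w e) < 1} :=
        isOpen_lt (by fun_prop) continuous_const
      have hne : {w : Eucl m | Real.cos (2 * Real.pi * inner ℝ w e) < 1}.Nonempty := by
        -- At `e/2` the phase equals `π`.
        refine ⟨(1 / 2 : ℝ) • e, ?_⟩
        rw [mem_ofPred_eq, real_inner_smul_left, real_inner_self_eq_norm_sq, he,
          show 2 * Real.pi * (1 / 2 * 1 ^ 2) = Real.pi by ring, Real.cos_pi]
        norm_num
      refine (hopen.measure_pos volume hne).trans_le (measure_mono fun w hw => ?_)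
      have hw' : Real.cos (2 * Real.pi * inner ℝ w e) < 1 := hw
      have hw0 : 0 < ‖w‖ := by
        rw [norm_pos_iff]
        rintro rfl
        simp at hw'
      rw [Function.mem_support]
      have : 0 < ‖w‖ ^ (-((m : ℝ) + s)) := Real.rpow_pos_of_pos hw0 _
      exact (mul_pos this (by linarith)).ne'
    · intro w
      exact mul_nonneg (by positivity) (by linarith [Real.cos_le_one (2 * Real.pi * inner ℝ w e)])
  · have hconj : (starRingEnd ℂ) (symb s e) = symb s e := by
      unfold symb hyper
      rw [← integral_conj, ← integral_neg_eq_self]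
      congr with w
      simp [conj_wave, wave_zero]
    exact (Complex.conj_eq_iff_re.1 hconj).symm

end

/-! ### Inversion of the fractional Laplacian by the Riesz potential -/

/-- Euler's Gamma integral after the substitution `b ↦ 1/b`. -/
lemma integral_rpow_mul_exp_neg_div {k ρ : ℝ} (hk : 0 < k) (hρ : 0 < ρ) :
    ∫ b in Ioi (0 : ℝ), b ^ (-k - 1) * Real.exp (-(ρ / b)) = ρ ^ (-k) * Real.Gamma k := by
  have h1 := Real.integral_rpow_mul_exp_neg_mul_Ioi hk hρ
  rw [← integral_comp_rpow_Ioi _ (p := -1) (by norm_num)] at h1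
  rw [one_div, Real.inv_rpow hρ.le, ← Real.rpow_neg hρ.le] at h1
  rw [← h1]
  refine setIntegral_congr_fun measurableSet_Ioi fun b (hb : 0 < b) => ?_
  simp only [abs_neg, abs_one, one_mul, smul_eq_mul]
  rw [← mul_assoc, ← Real.rpow_mul hb.le, ← Real.rpow_add hb, Real.rpow_neg_one, div_eq_mul_inv]
  congr 2; ring

lemma integrableOn_rpow_mul_exp_neg_div {k ρ : ℝ} (hk : 0 < k) (hρ : 0 < ρ) :
    IntegrableOn (fun b : ℝ => b ^ (-k - 1) * Real.exp (-(ρ / b))) (Ioi 0) := by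
  apply Integrable.of_integral_ne_zero
  rw [integral_rpow_mul_exp_neg_div hk hρ]
  have := Real.Gamma_pos_of_pos hk
  positivity

lemma integrableOn_rpow_mul_exp_neg_mul {k ρ : ℝ} (hk : 0 < k) (hρ : 0 < ρ) :
    IntegrableOn (fun b : ℝ => b ^ (k - 1) * Real.exp (-(ρ * b))) (Ioi 0) := by
  apply Integrable.of_integral_ne_zero
  rw [Real.integral_rpow_mul_exp_neg_mul_Ioi hk hρ]
  have := Real.Gamma_pos_of_pos hk
  positivity

section

variable {m : ℕ}

/-- The multiplication formula for the Fourier transform, applied to `g` and the Gaussian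
`exp(-b‖w‖²)` modulated by `x`, whose transform is the Gaussian centred at `x` on the left. -/
lemma gaussian_duality {g : Eucl m → ℂ} (hg : Integrable g) (x : Eucl m) {b : ℝ} (hb : 0 < b) :
    ∫ y, ((Real.pi / b) ^ ((m : ℝ) / 2) * Real.exp (-(Real.pi ^ 2 * ‖x - y‖ ^ 2 / b)) : ℝ) • g y =
      ∫ ξ, (Real.exp (-(‖ξ‖ ^ 2 * b)) : ℝ) • (wave ξ x * 𝓕 g ξ) := by
  have hb' : 0 < (b : ℂ).re := by simpa
  have J : Integrable (fun w : Eucl m =>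
      Complex.exp (- (b : ℂ) * ‖w‖ ^ 2 + 2 * Real.pi * Complex.I * (inner ℝ x w : ℝ))) :=
    GaussianFourier.integrable_cexp_neg_mul_sq_norm_add hb' _ _
  have key := VectorFourier.integral_fourierIntegral_smul_eq_flip (L := innerₗ (Eucl m))
      Real.continuous_fourierChar continuous_inner J hg
  have hflip : (innerₗ (Eucl m)).flip = innerₗ (Eucl m) := by
    ext v w; simp
  rw [hflip] at key
  change ∫ ξ, (𝓕 (fun w : Eucl m =>
    Complex.exp (- (b : ℂ) * ‖w‖ ^ 2 + 2 * Real.pi * Complex.I * (inner ℝ x w : ℝ))) ξ) • g ξ =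
    ∫ ξ, Complex.exp (- (b : ℂ) * ‖ξ‖ ^ 2 + 2 * Real.pi * Complex.I * (inner ℝ x ξ : ℝ)) • 𝓕 g ξ
    at key
  simp_rw [fourier_gaussian_innerProductSpace' hb'] at key
  convert key using 1
  · congr with y
    rw [← Complex.coe_smul]
    congr 1
    rw [Complex.ofReal_mul, Complex.ofReal_exp, Complex.ofReal_cpow (by positivity)]
    congr 2
    · push_cast; rfl
    · simp
    · push_cast; ring
  · congr with ξ
    rw [← Complex.coe_smul, smul_eq_mul, smul_eq_mul, ← mul_assoc]
    congr 1
    rw [Complex.ofReal_exp, wave, ← Complex.exp_add]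
    congr 1
    push_cast
    ring

/-- Integrating the Gaussians against `b^(α/2-1)` produces `Γ(α/2) ‖ξ‖^(-α)`, which cancels the
symbol `‖ξ‖^α`. -/
lemma integral_spectral_side {α : ℝ} (hα : 0 < α) {φ : Eucl m → ℂ} (hφ : Integrable φ)
    (hφ0 : Continuous φ) (hm : 1 ≤ m) (x : Eucl m) :
    ∫ b in Ioi (0 : ℝ), b ^ (α / 2 - 1) • ∫ ξ, (Real.exp (-(‖ξ‖ ^ 2 * b)) : ℝ) •
      (wave ξ x * ((‖ξ‖ ^ α : ℝ) • φ ξ)) = Real.Gamma (α / 2) • ∫ ξ, wave ξ x * φ ξ := by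
  have := nontrivial_eucl hm
  have hα2 : 0 < α / 2 := by positivity
  have hae : ∀ᵐ ξ : Eucl m, ξ ≠ 0 := by simp [ae_iff]
  have hpow : ∀ ξ : Eucl m, ξ ≠ 0 → (1 / ‖ξ‖ ^ 2) ^ (α / 2) * ‖ξ‖ ^ α = 1 := fun ξ hξ => by
    have h0 : 0 < ‖ξ‖ := norm_pos_iff.2 hξ
    rw [one_div, Real.inv_rpow (by positivity), ← Real.rpow_natCast, ← Real.rpow_mul h0.le]
    rw [show ((2 : ℕ) : ℝ) * (α / 2) = α by push_cast; ring]
    exact inv_mul_cancel₀ (by positivity)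
  have hnorm : ∀ ξ b, 0 < b → ‖b ^ (α / 2 - 1) • (Real.exp (-(‖ξ‖ ^ 2 * b)) : ℝ) •
      (wave ξ x * ((‖ξ‖ ^ α : ℝ) • φ ξ))‖ =
      (b ^ (α / 2 - 1) * Real.exp (-(‖ξ‖ ^ 2 * b))) * (‖ξ‖ ^ α * ‖φ ξ‖) := by
    intro ξ b hb
    rw [norm_smul, norm_smul, norm_mul, norm_wave, norm_smul, Real.norm_of_nonneg (by positivity),
      Real.norm_of_nonneg (by positivity), Real.norm_of_nonneg (by positivity)]
    ring
  have hcw := continuous_wave_uncurry (m := m)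
  have key : Integrable (fun p : ℝ × Eucl m => p.1 ^ (α / 2 - 1) •
      (Real.exp (-(‖p.2‖ ^ 2 * p.1)) : ℝ) • (wave p.2 x * ((‖p.2‖ ^ α : ℝ) • φ p.2)))
      ((volume.restrict (Ioi 0)).prod volume) := by
    -- Integrating the norm in `b` first gives exactly `Γ(α/2) ‖φ ξ‖`, so integrability of `φ` is
    -- enough.
    rw [integrable_prod_iff']
    · constructor
      · filter_upwards [hae] with ξ hξ
        have h0 : 0 < ‖ξ‖ := norm_pos_iff.2 hξ
        have := (integrableOn_rpow_mul_exp_neg_mul hα2 (by positivity : 0 < ‖ξ‖ ^ 2)).smul_const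
          (wave ξ x * ((‖ξ‖ ^ α : ℝ) • φ ξ))
        simpa only [smul_smul] using this
      · refine (hφ.norm.const_mul (Real.Gamma (α / 2))).congr ?_
        filter_upwards [hae] with ξ hξ
        have h0 : 0 < ‖ξ‖ := norm_pos_iff.2 hξ
        rw [setIntegral_congr_fun measurableSet_Ioi (fun b (hb : 0 < b) => hnorm ξ b hb),
          integral_mul_const, Real.integral_rpow_mul_exp_neg_mul_Ioi hα2 (by positivity)]
        calc _ = ((1 / ‖ξ‖ ^ 2) ^ (α / 2) * ‖ξ‖ ^ α) * (Real.Gamma (α / 2) * ‖φ ξ‖) := by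
              rw [hpow ξ hξ, one_mul]
          _ = _ := by ring
    · have h1 : AEStronglyMeasurable (fun p : ℝ × Eucl m => p.1 ^ (α / 2 - 1))
          ((volume.restrict (Ioi 0)).prod volume) :=
        Measurable.aestronglyMeasurable (by fun_prop)
      have h2 : AEStronglyMeasurable (fun p : ℝ × Eucl m => Real.exp (-(‖p.2‖ ^ 2 * p.1)))
          ((volume.restrict (Ioi 0)).prod volume) :=
        Measurable.aestronglyMeasurable (by fun_prop)
      have h3 : Continuous fun p : ℝ × Eucl m => ‖p.2‖ ^ α :=
        Continuous.rpow_const (by fun_prop) fun _ => Or.inr hα.le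
      have h4 : Continuous fun p : ℝ × Eucl m => φ p.2 := hφ0.comp continuous_snd
      have h5 : Continuous fun p : ℝ × Eucl m => wave p.2 x :=
        hcw.comp (continuous_snd.prodMk continuous_const)
      exact h1.smul (h2.smul (h5.mul (h3.smul h4)).aestronglyMeasurable)
  simp_rw [← integral_smul]
  rw [integral_integral_swap key]
  refine integral_congr_ae ?_
  filter_upwards [hae] with ξ hξ
  have h0 : 0 < ‖ξ‖ := norm_pos_iff.2 hξ
  simp_rw [smul_smul]
  rw [integral_smul_const, Real.integral_rpow_mul_exp_neg_mul_Ioi hα2 (by positivity),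
    mul_smul_comm, smul_smul, mul_right_comm, hpow ξ hξ, one_mul]

/-- The same average over `b`, taken on the space side: the Gaussians add up to a multiple of the
Riesz kernel. -/
lemma integral_physical_side {α : ℝ} (hαm : α < m) {g : Eucl m → ℂ}
    (hg0 : StronglyMeasurable g) (hm : 1 ≤ m) (x : Eucl m)
    (hgx : Integrable fun y => ‖x - y‖ ^ (-((m : ℝ) - α)) • g y) :
    ∫ b in Ioi (0 : ℝ), b ^ (α / 2 - 1) • ∫ y, ((Real.pi / b) ^ ((m : ℝ) / 2) *
      Real.exp (-(Real.pi ^ 2 * ‖x - y‖ ^ 2 / b)) : ℝ) • g y =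
    (Real.pi ^ ((m : ℝ) / 2) * (Real.pi ^ (-((m : ℝ) - α)) * Real.Gamma (((m : ℝ) - α) / 2))) •
      ∫ y, ‖x - y‖ ^ (-((m : ℝ) - α)) • g y := by
  have := nontrivial_eucl hm
  set k := ((m : ℝ) - α) / 2 with hk
  have hk0 : 0 < k := by rw [hk]; linarith
  have hpi := Real.pi_pos
  have hae : ∀ᵐ y : Eucl m, 0 < ‖x - y‖ := by
    have : ∀ᵐ y : Eucl m, y ≠ x := by simp [ae_iff]
    filter_upwards [this] with y hy using norm_pos_iff.2 (sub_ne_zero.2 hy.symm)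
  have hrho : ∀ r : ℝ, 0 < r → (Real.pi ^ 2 * r ^ 2) ^ (-k) =
      Real.pi ^ (-((m : ℝ) - α)) * r ^ (-((m : ℝ) - α)) := by
    intro r hr
    rw [← mul_pow, ← Real.rpow_natCast, ← Real.rpow_mul (by positivity),
      Real.mul_rpow hpi.le hr.le, hk]
    congr 2 <;> · push_cast; ring
  have hb : ∀ b r : ℝ, 0 < b → b ^ (α / 2 - 1) * ((Real.pi / b) ^ ((m : ℝ) / 2) *
      Real.exp (-(Real.pi ^ 2 * r ^ 2 / b))) = Real.pi ^ ((m : ℝ) / 2) *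
      (b ^ (-k - 1) * Real.exp (-(Real.pi ^ 2 * r ^ 2 / b))) := by
    intro b r hb
    rw [Real.div_rpow hpi.le hb.le, div_eq_mul_inv (Real.pi ^ ((m : ℝ) / 2)), ← Real.rpow_neg hb.le]
    rw [show -k - 1 = (α / 2 - 1) + -((m : ℝ) / 2) by rw [hk]; ring, Real.rpow_add hb]
    ring
  have hint : ∀ r : ℝ, 0 < r → IntegrableOn (fun b : ℝ => b ^ (α / 2 - 1) *
      ((Real.pi / b) ^ ((m : ℝ) / 2) * Real.exp (-(Real.pi ^ 2 * r ^ 2 / b)))) (Ioi 0) := by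
    intro r hr
    have := (integrableOn_rpow_mul_exp_neg_div hk0
      (by positivity : 0 < Real.pi ^ 2 * r ^ 2)).const_mul (Real.pi ^ ((m : ℝ) / 2))
    exact IntegrableOn.congr_fun this (fun b hb' => (hb b r hb').symm) measurableSet_Ioi
  have hval : ∀ r : ℝ, 0 < r → ∫ b in Ioi (0 : ℝ), b ^ (α / 2 - 1) *
      ((Real.pi / b) ^ ((m : ℝ) / 2) * Real.exp (-(Real.pi ^ 2 * r ^ 2 / b))) =
      (Real.pi ^ ((m : ℝ) / 2) * (Real.pi ^ (-((m : ℝ) - α)) * Real.Gamma k)) *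
        r ^ (-((m : ℝ) - α)) := by
    intro r hr
    rw [setIntegral_congr_fun measurableSet_Ioi (fun b hb' => hb b r hb'), integral_const_mul,
      integral_rpow_mul_exp_neg_div hk0 (by positivity), hrho r hr]
    ring
  have key : Integrable (fun p : ℝ × Eucl m => p.1 ^ (α / 2 - 1) • ((Real.pi / p.1) ^ ((m : ℝ) / 2) *
      Real.exp (-(Real.pi ^ 2 * ‖x - p.2‖ ^ 2 / p.1)) : ℝ) • g p.2)
      ((volume.restrict (Ioi 0)).prod volume) := by
    rw [integrable_prod_iff']
    · constructor
      · filter_upwards [hae] with y hy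
        have := (hint _ hy).smul_const (g y)
        simpa only [smul_smul] using this
      · refine (hgx.norm.const_mul (Real.pi ^ ((m : ℝ) / 2) *
          (Real.pi ^ (-((m : ℝ) - α)) * Real.Gamma k))).congr ?_
        filter_upwards [hae] with y hy
        have hnorm : ∀ b : ℝ, 0 < b → ‖b ^ (α / 2 - 1) • ((Real.pi / b) ^ ((m : ℝ) / 2) *
            Real.exp (-(Real.pi ^ 2 * ‖x - y‖ ^ 2 / b)) : ℝ) • g y‖ =
            (b ^ (α / 2 - 1) * ((Real.pi / b) ^ ((m : ℝ) / 2) *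
              Real.exp (-(Real.pi ^ 2 * ‖x - y‖ ^ 2 / b)))) * ‖g y‖ := by
          intro b hb
          rw [smul_smul, norm_smul, Real.norm_of_nonneg (by positivity)]
        rw [setIntegral_congr_fun measurableSet_Ioi (fun b (hb : 0 < b) => hnorm b hb),
          integral_mul_const, hval _ hy, norm_smul, Real.norm_of_nonneg (by positivity)]
        ring
    · have h1 : AEStronglyMeasurable (fun p : ℝ × Eucl m => p.1 ^ (α / 2 - 1))
          ((volume.restrict (Ioi 0)).prod volume) :=
        Measurable.aestronglyMeasurable (by fun_prop)
      have h2 : AEStronglyMeasurable (fun p : ℝ × Eucl m => (Real.pi / p.1) ^ ((m : ℝ) / 2) *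
          Real.exp (-(Real.pi ^ 2 * ‖x - p.2‖ ^ 2 / p.1)))
          ((volume.restrict (Ioi 0)).prod volume) :=
        Measurable.aestronglyMeasurable (by fun_prop)
      exact h1.smul (h2.smul (hg0.comp_measurable measurable_snd).aestronglyMeasurable)
  simp_rw [← integral_smul]
  rw [integral_integral_swap key]
  refine integral_congr_ae ?_
  filter_upwards [hae] with y hy
  simp_rw [smul_smul]
  rw [integral_smul_const, hval _ hy]

lemma integrable_ker_smul (hm : 1 ≤ m) {β : ℝ} (hβ : 0 < β) (hβm : β ≤ m) {F : Type*}
    [NormedAddCommGroup F] [NormedSpace ℝ F] {g : Eucl m → F} (hg : StronglyMeasurable g)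
    (hgi : Integrable g) {C : ℝ} (hC : ∀ y, ‖g y‖ ≤ C) (x : Eucl m) :
    Integrable fun y => ‖x - y‖ ^ (-((m : ℝ) - β)) • g y := by
  refine ⟨AEStronglyMeasurable.smul (Measurable.aestronglyMeasurable (by fun_prop))
    hg.aestronglyMeasurable, ?_⟩
  have h := pot_le hβm hg.enorm (M := ENNReal.ofReal C) (fun y => by
    rw [← ofReal_norm]; exact ENNReal.ofReal_le_ofReal (hC y)) x
  have hn : nearMass m β ≠ ∞ := lintegral_near_ne_top hm hβ
  have hi : ∫⁻ y, ‖g y‖ₑ ≠ ∞ := hgi.2.ne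
  refine lt_of_le_of_lt (le_of_eq ?_) (h.trans_lt (by finiteness : _ ≠ ∞).lt_top)
  unfold pot
  congr with y
  rw [enorm_smul, Real.enorm_of_nonneg (by positivity)]

lemma riesz_eq {F : Type*} [NormedAddCommGroup F] [NormedSpace ℝ F] (s : ℝ) (f : Eucl m → F)
    (x : Eucl m) : riesz s f x = ∫ y, ‖x - y‖ ^ (-((m : ℝ) - s)) • f y := by
  unfold riesz
  rw [← integral_add_left_eq_self (fun y => ‖x - y‖ ^ (-((m : ℝ) - s)) • f y) x]
  congr with z
  rw [sub_add_cancel_left, norm_neg]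

/-- Averaging `gaussian_duality` for `g = hyper α f` over `b` gives a multiple of `riesz α (hyper α
f) x` on one side. On the other, the symbol cancels and Fourier inversion returns a multiple of `f
x`. -/
lemma exists_riesz_hyper_complex (hm : 1 ≤ m) {α : ℝ} (hα : 0 < α) (hα1 : α < 1) :
    ∃ κ : ℝ, 0 < κ ∧ ∀ (f : 𝓢(Eucl m, ℂ)) (x : Eucl m), riesz α (hyper α f) x = κ • f x := by
  have hαm : α < m := hα1.trans_le (by exact_mod_cast hm)
  have := nontrivial_eucl hm
  obtain ⟨e, he⟩ := exists_norm_eq (Eucl m) zero_le_one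
  obtain ⟨κ, hκ, hκe⟩ := symb_pos hm hα hα1 he
  have hΓ1 := Real.Gamma_pos_of_pos (by positivity : 0 < α / 2)
  have hΓ2 := Real.Gamma_pos_of_pos (by linarith : 0 < ((m : ℝ) - α) / 2)
  have hpi := Real.pi_pos
  set c := Real.pi ^ ((m : ℝ) / 2) * (Real.pi ^ (-((m : ℝ) - α)) * Real.Gamma (((m : ℝ) - α) / 2))
    with hc
  have hc0 : 0 < c := by positivity
  refine ⟨c⁻¹ * (Real.Gamma (α / 2) * κ), by positivity, fun f x => ?_⟩
  have hf := lipDecay_schwartz f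
  have hgi := hf.integrable_hyper' hm hα hα1
  have hgm := stronglyMeasurable_hyper α hf.continuous
  obtain ⟨C, hC⟩ := hf.bddLip.hyper_bounded hm hα hα1
  have hphys := integral_physical_side hαm hgm hm x
    (integrable_ker_smul hm hα hαm.le hgm hgi hC x)
  rw [← riesz_eq, ← hc] at hphys
  have hφ : 𝓕 (f : Eucl m → ℂ) = (𝓕 f : 𝓢(Eucl m, ℂ)) := (SchwartzMap.fourier_coe f).symm
  have hspec := integral_spectral_side hα (φ := fun ξ => (κ : ℂ) * (𝓕 f : 𝓢(Eucl m, ℂ)) ξ)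
    ((𝓕 f).integrable.const_mul (κ : ℂ))
    (continuous_const.mul (𝓕 f).continuous) hm x
  have hinv : ∫ ξ, wave ξ x * (𝓕 f : 𝓢(Eucl m, ℂ)) ξ = f x := by
    have h := Continuous.fourierInv_fourier_eq f.continuous f.integrable
      (hφ ▸ (𝓕 f).integrable)
    rw [← hφ]
    conv_rhs => rw [← h, Real.fourierInv_eq']
    congr with ξ
    rw [smul_eq_mul, wave, real_inner_comm, mul_comm Complex.I]
  have hmid : ∀ b ∈ Ioi (0 : ℝ), b ^ (α / 2 - 1) • ∫ y, ((Real.pi / b) ^ ((m : ℝ) / 2) *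
      Real.exp (-(Real.pi ^ 2 * ‖x - y‖ ^ 2 / b)) : ℝ) • hyper α f y =
      b ^ (α / 2 - 1) • ∫ ξ, (Real.exp (-(‖ξ‖ ^ 2 * b)) : ℝ) •
      (wave ξ x * ((‖ξ‖ ^ α : ℝ) • ((κ : ℂ) * (𝓕 f : 𝓢(Eucl m, ℂ)) ξ))) := by
    intro b hb
    rw [gaussian_duality hgi x hb]
    congr with ξ
    rw [fourier_hyper hm hα hα1 hf, symb_eq hα he ξ, hκe, hφ, smul_mul_assoc]
  rw [setIntegral_congr_fun measurableSet_Ioi hmid, hspec] at hphys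
  have hκint : ∫ ξ, wave ξ x * ((κ : ℂ) * (𝓕 f : 𝓢(Eucl m, ℂ)) ξ) = (κ : ℂ) * f x := by
    rw [← hinv, ← integral_const_mul]
    congr with ξ
    ring
  rw [hκint] at hphys
  rw [mul_smul, eq_inv_smul_iff₀ hc0.ne', ← hphys, mul_smul, ← Complex.coe_smul κ, smul_eq_mul]

section

variable {F G : Type*} [NormedAddCommGroup F] [NormedSpace ℝ F] [CompleteSpace F]
  [NormedAddCommGroup G] [NormedSpace ℝ G] [CompleteSpace G]

lemma map_riesz_hyper (hm : 1 ≤ m) {α : ℝ} (hα : 0 < α) (hα1 : α < 1) (L : F →L[ℝ] G)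
    {f : Eucl m → F} (hf : LipDecay f) (x : Eucl m) :
    L (riesz α (hyper α f) x) = riesz α (hyper α fun y => L (f y)) x := by
  have hαm : α ≤ m := hα1.le.trans (by exact_mod_cast hm)
  have hh : ∀ y, L (hyper α f y) = hyper α (fun y => L (f y)) y := fun y => by
    unfold hyper
    rw [← ContinuousLinearMap.integral_comp_comm _ (hf.bddLip.integrable_hyper hm hα hα1 y)]
    congr with w
    rw [map_smul, map_sub]
  obtain ⟨C, hC⟩ := hf.bddLip.hyper_bounded hm hα hα1
  rw [riesz_eq, riesz_eq, ← ContinuousLinearMap.integral_comp_comm _ (integrable_ker_smul hm hα hαm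
    (stronglyMeasurable_hyper α hf.continuous) (hf.integrable_hyper' hm hα hα1) hC x)]
  congr with y
  rw [map_smul, hh]

end

lemma exists_riesz_hyper (𝕜 : Type*) [RCLike 𝕜] (hm : 1 ≤ m) {α : ℝ} (hα : 0 < α) (hα1 : α < 1) :
    ∃ κ : ℝ, 0 < κ ∧ ∀ (f : 𝓢(Eucl m, 𝕜)) (x : Eucl m), riesz α (hyper α f) x = κ • f x := by
  obtain ⟨κ, hκ, h⟩ := exists_riesz_hyper_complex hm hα hα1
  refine ⟨κ, hκ, fun f x => ?_⟩
  -- A real-linear embedding of the scalars into `ℂ`; it commutes with both operators and so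
  -- transfers the complex identity.
  let L : 𝕜 →L[ℝ] ℂ := Complex.ofRealCLM ∘L RCLike.reCLM +
    (Complex.I • Complex.ofRealCLM) ∘L RCLike.imCLM
  have hL : ∀ z, L z = (RCLike.re z : ℝ) + Complex.I * (RCLike.im z : ℝ) := fun z => by
    simp [L]
  have hinj : Function.Injective L := by
    intro z w hzw
    rw [hL, hL] at hzw
    apply RCLike.ext
    · simpa using congr_arg Complex.re hzw
    · simpa using congr_arg Complex.im hzw
  apply hinj
  rw [map_riesz_hyper hm hα hα1 L (lipDecay_schwartz f), map_smul]
  exact h (f.postcompCLM L) x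

end

/-! ### The pointwise kernel estimate -/

lemma abs_rpow_neg_sub_rpow_neg_le {k p q : ℝ} (hk : 0 < k) (hp : 0 < p) (hq : p / 2 ≤ q) :
    |p ^ (-k) - q ^ (-k)| ≤ k * (p / 2) ^ (-k - 1) * |p - q| := by
  have hp2 : 0 < p / 2 := by positivity
  have := (convex_Ici (p / 2)).norm_image_sub_le_of_norm_hasDerivWithin_le
    (f := fun t : ℝ => t ^ (-k)) (f' := fun t => -k * t ^ (-k - 1)) (C := k * (p / 2) ^ (-k - 1))
    (fun t (ht : p / 2 ≤ t) =>
      (Real.hasDerivAt_rpow_const (Or.inl (lt_of_lt_of_le hp2 ht).ne')).hasDerivWithinAt)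
    (fun t (ht : p / 2 ≤ t) => by
      have ht0 : 0 < t := by linarith
      rw [norm_mul, norm_neg, Real.norm_of_nonneg hk.le, Real.norm_of_nonneg (by positivity)]
      exact mul_le_mul_of_nonneg_left (Real.rpow_le_rpow_of_nonpos hp2 ht (by linarith)) hk.le)
    (show q ∈ Ici (p / 2) from hq) (show p ∈ Ici (p / 2) from by rw [mem_Ici]; linarith)
  simpa only [Real.norm_eq_abs] using this

/-- The constant in the pointwise kernel estimate. -/
noncomputable def kerConst (M : ℝ) : ℝ := M * 2 ^ (M + 1) + 1 + 3 ^ M * 3 * 2 ^ M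

section

variable {M α s γ₁ γ₂ p q r : ℝ}

/-- Here `q ≥ p/2`, so the mean value theorem gains `r/p`. Of this gain `(r/p)^γ₁` moves the
exponents to the required ones and the remaining `(r/p)^(1-γ₁)` is at most 1. -/
lemma kernel_le_of_near (hM : 1 ≤ M) (hα0 : 0 < α) (hα1 : α < 1) (hγ₁α : γ₁ < α) (hp : 0 < p)
    (hr : 0 < r) (h1 : p ≤ q + r) (h2 : q ≤ p + r) (h : r ≤ p / 2) :
    |p ^ (-(M - α)) - q ^ (-(M - α))| * r ^ (-(M + s)) ≤
      M * 2 ^ (M + 1) * (p ^ (-(M - (α - γ₁))) * r ^ (-(M - (γ₁ - s)))) := by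
  have hk : 0 < M - α := by linarith
  have hD : |p ^ (-(M - α)) - q ^ (-(M - α))| ≤
      M * (2 ^ (M + 1) * (p ^ (-(M - (α - γ₁))) * p ^ (-(1 - γ₁)))) * r := by
    calc _ ≤ (M - α) * (p / 2) ^ (-(M - α) - 1) * |p - q| :=
          abs_rpow_neg_sub_rpow_neg_le hk hp (by linarith)
      _ ≤ M * (2 ^ (M + 1) * p ^ (-(M - α) - 1)) * r := by
          gcongr
          · linarith
          · rw [Real.div_rpow hp.le zero_le_two, div_eq_mul_inv, ← Real.rpow_neg zero_le_two,
              mul_comm]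
            gcongr
            · norm_num
            · linarith
          · rw [abs_le]; constructor <;> linarith
      _ = _ := by
          rw [← Real.rpow_add hp]
          congr 4; ring
  have hrr : r * r ^ (-(M + s)) = r ^ (1 - γ₁) * r ^ (-(M - (γ₁ - s))) := by
    nth_rw 1 [← Real.rpow_one r]
    rw [← Real.rpow_add hr, ← Real.rpow_add hr]
    congr 1; ring
  have hpr : p ^ (-(1 - γ₁)) * r ^ (1 - γ₁) ≤ 1 := by
    rw [Real.rpow_neg hp.le, inv_mul_le_iff₀ (by positivity), mul_one]
    exact Real.rpow_le_rpow hr.le (by linarith) (by linarith)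
  calc _ ≤ M * (2 ^ (M + 1) * (p ^ (-(M - (α - γ₁))) * p ^ (-(1 - γ₁)))) * r * r ^ (-(M + s)) := by
        gcongr
    _ = M * 2 ^ (M + 1) * (p ^ (-(M - (α - γ₁))) * r ^ (-(M - (γ₁ - s)))) *
          (p ^ (-(1 - γ₁)) * r ^ (1 - γ₁)) := by
        rw [mul_assoc _ r, hrr]; ring
    _ ≤ _ := mul_le_of_le_one_right (by positivity) hpr

/-- Here `q ≥ r - p ≥ p`, so the difference is at most its first term; the spare factor is `(p/r)^γ₁
≤ 1`. -/
lemma kernel_le_of_far (hM : 1 ≤ M) (hα1 : α < 1) (hγ₁ : 0 ≤ γ₁) (hp : 0 < p)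
    (hq : 0 < q) (hr : 0 < r) (h3 : r ≤ p + q) (h : p ≤ r / 2) :
    |p ^ (-(M - α)) - q ^ (-(M - α))| * r ^ (-(M + s)) ≤
      p ^ (-(M - (α - γ₁))) * r ^ (-(M - (γ₁ - s))) := by
  have hD : |p ^ (-(M - α)) - q ^ (-(M - α))| ≤ p ^ (-(M - α)) := by
    have : q ^ (-(M - α)) ≤ p ^ (-(M - α)) :=
      Real.rpow_le_rpow_of_nonpos hp (by linarith) (by linarith)
    have : 0 ≤ q ^ (-(M - α)) := by positivity
    rw [abs_le]; constructor <;> linarith [(by positivity : 0 ≤ p ^ (-(M - α)))]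
  calc _ ≤ p ^ (-(M - α)) * r ^ (-(M + s)) := by gcongr
    _ = (p ^ (-(M - (α - γ₁))) * p ^ γ₁) * (r ^ (-(M - (γ₁ - s))) * r ^ (-γ₁)) := by
        rw [← Real.rpow_add hp, ← Real.rpow_add hr]
        congr 2 <;> ring
    _ = p ^ (-(M - (α - γ₁))) * r ^ (-(M - (γ₁ - s))) * (p ^ γ₁ * r ^ (-γ₁)) := by ring
    _ ≤ _ := by
        refine mul_le_of_le_one_right (by positivity) ?_
        rw [Real.rpow_neg hr.le, ← div_eq_mul_inv, div_le_one (by positivity)]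
        exact Real.rpow_le_rpow hp.le (by linarith) hγ₁

/-- Now `q` is at most `3p` and `3r` but may be arbitrarily small, so the power of `q` dominates the
difference. Half of `p` bounds `r` from below, which permits trading `r` for `p` at the cost of
`2^M`. -/
lemma kernel_le_of_comparable (hM : 1 ≤ M) (hα1 : α < 1) (hs : 0 ≤ s)
    (hsγ₂ : s < γ₂) (hγ₂α : γ₂ < α) (hp : 0 < p) (hq : 0 < q) (hr : 0 < r)
    (h2 : q ≤ p + r) (h : p / 2 ≤ r) (h' : r / 2 ≤ p) :
    |p ^ (-(M - α)) - q ^ (-(M - α))| * r ^ (-(M + s)) ≤ 3 ^ M * 3 * 2 ^ M *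
      min (q ^ (-(M - (α - γ₂))) * r ^ (-(M - (γ₂ - s))))
        (q ^ (-(M - (α - γ₂))) * p ^ (-(M - (γ₂ - s)))) := by
  have hqp : p ^ (-(M - α)) ≤ 3 ^ M * q ^ (-(M - α)) := by
    calc p ^ (-(M - α)) ≤ (q / 3) ^ (-(M - α)) :=
          Real.rpow_le_rpow_of_nonpos (by positivity) (by linarith) (by linarith)
      _ = 3 ^ (M - α) * q ^ (-(M - α)) := by
          rw [Real.div_rpow hq.le (by norm_num), Real.rpow_neg (by norm_num : (0 : ℝ) ≤ 3),
            div_inv_eq_mul, mul_comm]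
      _ ≤ _ := by gcongr; · norm_num
                  · linarith
  have h3M : (1 : ℝ) ≤ 3 ^ M := Real.one_le_rpow (by norm_num) (by linarith)
  have h2M : (1 : ℝ) ≤ 2 ^ M := Real.one_le_rpow (by norm_num) (by linarith)
  have hD : |p ^ (-(M - α)) - q ^ (-(M - α))| ≤ 3 ^ M * q ^ (-(M - α)) := by
    have h0 : 0 ≤ q ^ (-(M - α)) := by positivity
    have h1 : 0 ≤ p ^ (-(M - α)) := by positivity
    rw [abs_le]; constructor <;> nlinarith
  have hY : |p ^ (-(M - α)) - q ^ (-(M - α))| * r ^ (-(M + s)) ≤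
      3 ^ M * 3 * (q ^ (-(M - (α - γ₂))) * r ^ (-(M - (γ₂ - s)))) := by
    calc _ ≤ 3 ^ M * q ^ (-(M - α)) * r ^ (-(M + s)) := by gcongr
      _ = 3 ^ M * (q ^ (-(M - (α - γ₂))) * q ^ γ₂) * (r ^ (-(M - (γ₂ - s))) * r ^ (-γ₂)) := by
          rw [← Real.rpow_add hq, ← Real.rpow_add hr]
          congr 3 <;> ring
      _ = 3 ^ M * (q ^ γ₂ * r ^ (-γ₂)) * (q ^ (-(M - (α - γ₂))) * r ^ (-(M - (γ₂ - s)))) := by ring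
      _ ≤ _ := by
          gcongr
          rw [Real.rpow_neg hr.le, ← div_eq_mul_inv, ← Real.div_rpow hq.le hr.le]
          have hqr : q / r ≤ 3 := by rw [div_le_iff₀ hr]; linarith
          calc _ ≤ (3 : ℝ) ^ γ₂ := Real.rpow_le_rpow (by positivity) hqr (by linarith)
            _ ≤ 3 ^ (1 : ℝ) := Real.rpow_le_rpow_of_exponent_le (by norm_num) (by linarith)
            _ = 3 := Real.rpow_one 3
  have hrp : r ^ (-(M - (γ₂ - s))) ≤ 2 ^ M * p ^ (-(M - (γ₂ - s))) := by
    calc r ^ (-(M - (γ₂ - s))) ≤ (p / 2) ^ (-(M - (γ₂ - s))) :=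
          Real.rpow_le_rpow_of_nonpos (by positivity) h (by linarith)
      _ = 2 ^ (M - (γ₂ - s)) * p ^ (-(M - (γ₂ - s))) := by
          rw [Real.div_rpow hp.le (by norm_num), Real.rpow_neg (by norm_num : (0 : ℝ) ≤ 2),
            div_inv_eq_mul, mul_comm]
      _ ≤ _ := by gcongr; · norm_num
                  · linarith
  rw [mul_min_of_nonneg _ _ (by positivity)]
  refine le_min (hY.trans ?_) (hY.trans ?_)
  · exact mul_le_mul_of_nonneg_right (le_mul_of_one_le_right (by positivity) h2M) (by positivity)
  · calc _ ≤ 3 ^ M * 3 * (q ^ (-(M - (α - γ₂))) * (2 ^ M * p ^ (-(M - (γ₂ - s))))) := by gcongr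
      _ = _ := by ring

/-- The exponents `γ₁` and `γ₂` are independent because the product kernel and the minimum arise in
disjoint zones; part (ii) exploits this. -/
lemma kernel_le (hM : 1 ≤ M) (hα0 : 0 < α) (hα1 : α < 1) (hs : 0 ≤ s) (hsγ₁ : s < γ₁)
    (hγ₁α : γ₁ < α) (hsγ₂ : s < γ₂) (hγ₂α : γ₂ < α) (hp : 0 < p) (hq : 0 < q) (hr : 0 < r)
    (h1 : p ≤ q + r) (h2 : q ≤ p + r) (h3 : r ≤ p + q) :
    |p ^ (-(M - α)) - q ^ (-(M - α))| * r ^ (-(M + s)) ≤ kerConst M *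
      (p ^ (-(M - (α - γ₁))) * r ^ (-(M - (γ₁ - s))) +
        min (q ^ (-(M - (α - γ₂))) * r ^ (-(M - (γ₂ - s))))
          (q ^ (-(M - (α - γ₂))) * p ^ (-(M - (γ₂ - s))))) := by
  have hX : 0 ≤ p ^ (-(M - (α - γ₁))) * r ^ (-(M - (γ₁ - s))) := by positivity
  have hY : 0 ≤ min (q ^ (-(M - (α - γ₂))) * r ^ (-(M - (γ₂ - s))))
          (q ^ (-(M - (α - γ₂))) * p ^ (-(M - (γ₂ - s)))) := le_min (by positivity) (by positivity)
  set X := p ^ (-(M - (α - γ₁))) * r ^ (-(M - (γ₁ - s)))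
  set Y := min (q ^ (-(M - (α - γ₂))) * r ^ (-(M - (γ₂ - s))))
          (q ^ (-(M - (α - γ₂))) * p ^ (-(M - (γ₂ - s))))
  have c1 : 0 ≤ M * 2 ^ (M + 1) := by positivity
  have c2 : (0 : ℝ) ≤ 3 ^ M * 3 * 2 ^ M := by positivity
  have hK : kerConst M = M * 2 ^ (M + 1) + 1 + 3 ^ M * 3 * 2 ^ M := rfl
  rcases le_or_gt r (p / 2) with h | h
  · refine (kernel_le_of_near hM hα0 hα1 hγ₁α hp hr h1 h2 h).trans ?_
    refine mul_le_mul (by linarith) (by linarith) hX (by linarith)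
  rcases le_or_gt p (r / 2) with h' | h'
  · refine (kernel_le_of_far hM hα1 (hs.trans hsγ₁.le) hp hq hr h3 h').trans ?_
    exact (one_mul X).symm.trans_le
      (mul_le_mul (by linarith) (by linarith) hX (by linarith))
  · refine (kernel_le_of_comparable hM hα1 hs hsγ₂ hγ₂α hp hq hr h2 h.le h'.le).trans ?_
    exact mul_le_mul (by linarith) (by linarith) hY (by linarith)

end

/-! ### The commutator estimate -/

section

variable {m : ℕ}

/-- The minimum sits inside the pointwise bound; estimating it by whichever branch has the smaller
integral yields the minimum of the two nested potentials. -/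
lemma lintegral_kernel_le (hm : 1 ≤ m) {α s γ₁ γ₂ : ℝ} (hα0 : 0 < α) (hα1 : α < 1) (hs : 0 ≤ s)
    (hsγ₁ : s < γ₁) (hγ₁α : γ₁ < α) (hsγ₂ : s < γ₂) (hγ₂α : γ₂ < α) {A v : Eucl m → ℝ≥0∞}
    (hA : Measurable A) (hv : Measurable v) (x : Eucl m) :
    ∫⁻ y, ∫⁻ z, ENNReal.ofReal (|‖x - z‖ ^ (-((m : ℝ) - α)) - ‖y - z‖ ^ (-((m : ℝ) - α))| *
        ‖x - y‖ ^ (-((m : ℝ) + s))) * (A z * v y) ≤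
      ENNReal.ofReal (kerConst m) * (pot (α - γ₁) A x * pot (γ₁ - s) v x +
        min (pot (γ₂ - s) (fun y => v y * pot (α - γ₂) A y) x)
          (pot (γ₂ - s) (fun y => pot (α - γ₂) v y * A y) x)) := by
  have := nontrivial_eucl hm
  have hM : (1 : ℝ) ≤ m := by exact_mod_cast hm
  have hK : 0 ≤ kerConst m := by unfold kerConst; positivity
  obtain ⟨k, hk⟩ : ∃ k : ℝ → Eucl m → ℝ≥0∞,
    k = fun (β : ℝ) (w : Eucl m) => ENNReal.ofReal (‖w‖ ^ (-((m : ℝ) - β))) := ⟨_, rfl⟩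
  have mk : ∀ β, Measurable (k β) := fun β => hk ▸ measurable_ker β
  have hpot : ∀ (β : ℝ) (g : Eucl m → ℝ≥0∞) (w : Eucl m),
      pot β g w = ∫⁻ y, k β (w - y) * g y := fun β g w => by rw [hk]; rfl
  have hne : ∀ w : Eucl m, ∀ᵐ y : Eucl m, y ≠ w := fun w => by simp [ae_iff]
  have hpt : ∀ᵐ y : Eucl m, ∀ᵐ z : Eucl m,
      ENNReal.ofReal (|‖x - z‖ ^ (-((m : ℝ) - α)) - ‖y - z‖ ^ (-((m : ℝ) - α))| *
        ‖x - y‖ ^ (-((m : ℝ) + s))) * (A z * v y) ≤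
      ENNReal.ofReal (kerConst m) * ((k (α - γ₁) (x - z) * A z) * (k (γ₁ - s) (x - y) * v y) +
        min (k (γ₂ - s) (x - y) * v y * (k (α - γ₂) (y - z) * A z))
          (k (γ₂ - s) (x - z) * A z * (k (α - γ₂) (z - y) * v y))) := by
    filter_upwards [hne x] with y hy
    filter_upwards [hne x, hne y] with z hzx hzy
    have hp : 0 < ‖x - z‖ := norm_pos_iff.2 (sub_ne_zero.2 hzx.symm)
    have hq : 0 < ‖y - z‖ := norm_pos_iff.2 (sub_ne_zero.2 hzy.symm)
    have hr : 0 < ‖x - y‖ := norm_pos_iff.2 (sub_ne_zero.2 hy.symm)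
    have h1 : ‖x - z‖ ≤ ‖y - z‖ + ‖x - y‖ := by
      rw [add_comm]; exact norm_sub_le_norm_sub_add_norm_sub x y z
    have h2 : ‖y - z‖ ≤ ‖x - z‖ + ‖x - y‖ := by
      rw [add_comm, norm_sub_rev x y]; exact norm_sub_le_norm_sub_add_norm_sub y x z
    have h3 : ‖x - y‖ ≤ ‖x - z‖ + ‖y - z‖ := by
      rw [norm_sub_rev y z]; exact norm_sub_le_norm_sub_add_norm_sub x z y
    calc _ ≤ _ := mul_le_mul_left (ENNReal.ofReal_le_ofReal
          (kernel_le hM hα0 hα1 hs hsγ₁ hγ₁α hsγ₂ hγ₂α hp hq hr h1 h2 h3)) (A z * v y)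
      _ = ENNReal.ofReal (kerConst m) * ((k (α - γ₁) (x - z) * k (γ₁ - s) (x - y)) +
            min (k (α - γ₂) (y - z) * k (γ₂ - s) (x - y))
              (k (α - γ₂) (z - y) * k (γ₂ - s) (x - z))) * (A z * v y) := by
          rw [ENNReal.ofReal_mul hK, ENNReal.ofReal_add (by positivity)
            (le_min (by positivity) (by positivity)), ENNReal.ofReal_min,
            ENNReal.ofReal_mul (by positivity), ENNReal.ofReal_mul (by positivity),
            ENNReal.ofReal_mul (by positivity)]
          simp only [hk, norm_sub_rev z y]
      _ = ENNReal.ofReal (kerConst m) * ((k (α - γ₁) (x - z) * k (γ₁ - s) (x - y)) * (A z * v y) +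
            min ((k (α - γ₂) (y - z) * k (γ₂ - s) (x - y)) * (A z * v y))
              ((k (α - γ₂) (z - y) * k (γ₂ - s) (x - z)) * (A z * v y))) := by
          rw [mul_assoc, add_mul, min_mul_of_nonneg _ _ zero_le]
      _ = _ := by
          congr 2
          · ring
          · congr 1 <;> ring
  have mkx : ∀ β, Measurable fun z : Eucl m => k β (x - z) := fun β =>
    (mk β).comp (measurable_const.sub measurable_id)
  have mkz : ∀ β (y : Eucl m), Measurable fun z : Eucl m => k β (y - z) := fun β y =>
    (mk β).comp (measurable_const.sub measurable_id)
  have mkA : ∀ β, Measurable fun z => k β (x - z) * A z := fun β => (mkx β).mul hA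
  have mkv : ∀ β, Measurable fun z => k β (x - z) * v z := fun β => (mkx β).mul hv
  have mkd : ∀ β, Measurable fun p : Eucl m × Eucl m => k β (p.1 - p.2) := fun β =>
    (mk β).comp (measurable_fst.sub measurable_snd)
  have e1 : ∫⁻ y, ∫⁻ z, (k (α - γ₁) (x - z) * A z) * (k (γ₁ - s) (x - y) * v y) =
      pot (α - γ₁) A x * pot (γ₁ - s) v x := by
    simp_rw [lintegral_mul_const _ (mkA _)]
    rw [lintegral_const_mul _ (mkv _), hpot, hpot]
  have e2 : ∫⁻ y, ∫⁻ z, k (γ₂ - s) (x - y) * v y * (k (α - γ₂) (y - z) * A z) =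
      pot (γ₂ - s) (fun y => v y * pot (α - γ₂) A y) x := by
    simp_rw [hpot]
    congr with y
    have h1 : Measurable fun z => k (α - γ₂) (y - z) * A z := (mkz _ y).mul hA
    rw [lintegral_const_mul _ h1, mul_assoc]
  -- In this branch the power of `r` has become one of `‖x - z‖`, so `z` is the outer variable and
  -- the order of integration is exchanged.
  have e3 : ∫⁻ y, ∫⁻ z, k (γ₂ - s) (x - z) * A z * (k (α - γ₂) (z - y) * v y) =
      pot (γ₂ - s) (fun y => pot (α - γ₂) v y * A y) x := by
    rw [lintegral_lintegral_swap]
    · simp_rw [hpot]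
      congr with z
      have h1 : Measurable fun y => k (α - γ₂) (z - y) * v y := (mkz _ z).mul hv
      rw [lintegral_const_mul _ h1]
      ring
    · refine Measurable.aemeasurable ?_
      have h1 : Measurable fun p : Eucl m × Eucl m => k (α - γ₂) (p.2 - p.1) :=
        (mkd (α - γ₂)).comp measurable_swap
      have h2 : Measurable fun p : Eucl m × Eucl m => k (γ₂ - s) (x - p.2) * A p.2 :=
        (mkA (γ₂ - s)).comp measurable_snd
      have h3 : Measurable fun p : Eucl m × Eucl m => v p.1 := hv.comp measurable_fst
      exact h2.mul (h1.mul h3)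
  have hsplit : ∀ {T : Eucl m → Eucl m → ℝ≥0∞},
      (∀ y z, min (k (γ₂ - s) (x - y) * v y * (k (α - γ₂) (y - z) * A z))
          (k (γ₂ - s) (x - z) * A z * (k (α - γ₂) (z - y) * v y)) ≤ T y z) →
      ∫⁻ y, ∫⁻ z, ENNReal.ofReal (|‖x - z‖ ^ (-((m : ℝ) - α)) - ‖y - z‖ ^ (-((m : ℝ) - α))| *
        ‖x - y‖ ^ (-((m : ℝ) + s))) * (A z * v y) ≤
      ENNReal.ofReal (kerConst m) * (pot (α - γ₁) A x * pot (γ₁ - s) v x + ∫⁻ y, ∫⁻ z, T y z) := by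
    intro T hT
    have hmeas : ∀ y, Measurable fun z => (k (α - γ₁) (x - z) * A z) * (k (γ₁ - s) (x - y) * v y) :=
      fun y => (mkA _).mul_const _
    have hmeas' : Measurable fun y =>
        ∫⁻ z, (k (α - γ₁) (x - z) * A z) * (k (γ₁ - s) (x - y) * v y) := by
      simp_rw [lintegral_mul_const _ (mkA _)]
      exact (mkv _).const_mul _
    rw [← e1, ← lintegral_add_left hmeas', ← lintegral_const_mul' _ _ ENNReal.ofReal_ne_top]
    refine lintegral_mono_ae ?_
    filter_upwards [hpt] with y hy
    rw [← lintegral_add_left (hmeas y), ← lintegral_const_mul' _ _ ENNReal.ofReal_ne_top]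
    refine lintegral_mono_ae ?_
    filter_upwards [hy] with z hz
    refine hz.trans ?_
    gcongr
    exact hT y z
  rcases le_total (pot (γ₂ - s) (fun y => v y * pot (α - γ₂) A y) x)
      (pot (γ₂ - s) (fun y => pot (α - γ₂) v y * A y) x) with h | h
  · rw [min_eq_left h, ← e2]
    exact hsplit fun y z => min_le_left _ _
  · rw [min_eq_right h, ← e3]
    exact hsplit fun y z => min_le_right _ _

/-! ### Passage between real and extended Riesz potentials -/

lemma rieszPotential_eq_pot (β : ℝ) {h : Eucl m → ℝ} (hh : Measurable h) (h0 : ∀ y, 0 ≤ h y)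
    (x : Eucl m) :
    rieszPotential β h x =
      rieszPotentialConst m β * (pot β (fun y => ENNReal.ofReal (h y)) x).toReal := by
  unfold rieszPotential pot
  rw [smul_eq_mul, integral_eq_lintegral_of_nonneg_ae (ae_of_all _ fun y => by
    simp only [Pi.zero_apply, smul_eq_mul]; have := h0 y; positivity)]
  · congr 3 with y
    rw [smul_eq_mul, ENNReal.ofReal_mul (by positivity)]
  · exact Measurable.aestronglyMeasurable (by fun_prop)

lemma rieszPotential_norm_eq_pot {F : Type*} [NormedAddCommGroup F] (β : ℝ) {f : Eucl m → F}
    (hf : StronglyMeasurable f) (x : Eucl m) :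
    rieszPotential β (fun y => ‖f y‖) x =
      rieszPotentialConst m β * (pot β (fun y => ‖f y‖ₑ) x).toReal := by
  rw [rieszPotential_eq_pot β hf.norm.measurable fun _ => norm_nonneg _]
  simp_rw [ofReal_norm]

lemma rieszPotentialConst_pos {β : ℝ} (hβ : 0 < β) (hβm : β < m) : 0 < rieszPotentialConst m β := by
  have h1 := Real.Gamma_pos_of_pos (by linarith : 0 < ((m : ℝ) - β) / 2)
  have h2 := Real.Gamma_pos_of_pos (by linarith : 0 < β / 2)
  have h3 := Real.pi_pos
  unfold rieszPotentialConst
  positivity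

lemma pot_mul_rieszPotential {F : Type*} [NormedAddCommGroup F] {β β' : ℝ} (hβ' : 0 < β')
    (hβ'm : β' < m) {f : Eucl m → F} (hf : StronglyMeasurable f) {w : Eucl m → ℝ}
    (hw : Measurable w) (hw0 : ∀ y, 0 ≤ w y)
    (hfin : ∀ y, pot β' (fun y => ‖f y‖ₑ) y ≠ ∞) (x : Eucl m) :
    rieszPotential β (fun y => w y * rieszPotential β' (fun z => ‖f z‖) y) x =
      rieszPotentialConst m β * rieszPotentialConst m β' *
        (pot β (fun y => ENNReal.ofReal (w y) * pot β' (fun z => ‖f z‖ₑ) y) x).toReal := by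
  have hc := (rieszPotentialConst_pos hβ' hβ'm).le
  have hmp : Measurable (pot β' fun z => ‖f z‖ₑ) := measurable_pot _ hf.enorm
  simp_rw [rieszPotential_norm_eq_pot β' hf]
  rw [rieszPotential_eq_pot]
  · have : ∀ y, ENNReal.ofReal (w y * (rieszPotentialConst m β' *
        (pot β' (fun z => ‖f z‖ₑ) y).toReal)) = ENNReal.ofReal (rieszPotentialConst m β') *
        (ENNReal.ofReal (w y) * pot β' (fun z => ‖f z‖ₑ) y) := by
      intro y
      rw [ENNReal.ofReal_mul (hw0 y), ENNReal.ofReal_mul hc, ENNReal.ofReal_toReal (hfin y)]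
      ring
    simp_rw [this]
    rw [pot_const_mul _ (by fun_prop), ENNReal.toReal_mul, ENNReal.toReal_ofReal hc]
    ring
  · fun_prop
  · intro y
    have := hw0 y
    positivity

/-- The double-potential constant attached to an intermediate exponent. -/
noncomputable def pairConst (m : ℕ) (α s γ : ℝ) : ℝ :=
  rieszPotentialConst m (α - γ) * rieszPotentialConst m (γ - s)

lemma pairConst_pos (hm : 1 ≤ m) {α s γ : ℝ} (hα1 : α < 1) (hs : 0 ≤ s) (hsγ : s < γ)
    (hγα : γ < α) : 0 < pairConst m α s γ := by
  have hM : (1 : ℝ) ≤ m := by exact_mod_cast hm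
  exact mul_pos (rieszPotentialConst_pos (by linarith) (by linarith))
    (rieszPotentialConst_pos (by linarith) (by linarith))

variable {𝕜 : Type*} [RCLike 𝕜]

/-- The common estimate behind both parts. Finiteness of the potentials of `v` is a separate
hypothesis because `v` is not assumed integrable, and `I_s b` need not be. Once every potential is
finite, the extended bound equals the real-valued one, with no infinite value sent to `0` by
`toReal`. -/
lemma lintegral_difference_le (hm : 1 ≤ m) {α s γ₁ γ₂ : ℝ} (hα0 : 0 < α) (hα1 : α < 1) (hs : 0 ≤ s)
    (hsγ₁ : s < γ₁) (hγ₁α : γ₁ < α) (hsγ₂ : s < γ₂) (hγ₂α : γ₂ < α) {a A v : Eucl m → 𝕜} {μ : ℝ}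
    (hμ : 0 ≤ μ) (ha : ∀ x, a x = μ • ∫ z, ‖x - z‖ ^ (-((m : ℝ) - α)) • A z)
    (hA : StronglyMeasurable A) (hAi : Integrable A) {CA : ℝ} (hAb : ∀ y, ‖A y‖ ≤ CA)
    (hv : StronglyMeasurable v)
    (hvb : ∀ β, 0 < β → β < 1 - s → ∃ K : ℝ≥0∞, K ≠ ∞ ∧ ∀ y, pot β (fun z => ‖v z‖ₑ) y ≤ K)
    (x : Eucl m) :
    ∫⁻ y, ENNReal.ofReal (‖x - y‖ ^ (-((m : ℝ) + s))) * (‖a x - a y‖ₑ * ‖v y‖ₑ) ≤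
      ENNReal.ofReal (μ * kerConst m * ((pairConst m α s γ₁)⁻¹ *
        (rieszPotential (α - γ₁) (fun y => ‖A y‖) x * rieszPotential (γ₁ - s) (fun y => ‖v y‖) x) +
        (pairConst m α s γ₂)⁻¹ * min
          (rieszPotential (γ₂ - s)
            (fun y => ‖v y‖ * rieszPotential (α - γ₂) (fun z => ‖A z‖) y) x)
          (rieszPotential (γ₂ - s)
            (fun y => rieszPotential (α - γ₂) (fun z => ‖v z‖) y * ‖A y‖) x))) := by
  have hM : (1 : ℝ) ≤ m := by exact_mod_cast hm
  have hK : 0 ≤ kerConst m := by unfold kerConst; positivity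
  have hAint : ∀ x, Integrable fun z => ‖x - z‖ ^ (-((m : ℝ) - α)) • A z := fun x =>
    integrable_ker_smul hm hα0 (by linarith) hA hAi hAb x
  have hApot : ∀ {β : ℝ}, 0 < β → β < 1 → ∃ K : ℝ≥0∞, K ≠ ∞ ∧
      ∀ y, pot β (fun z => ‖A z‖ₑ) y ≤ K := by
    intro β hβ hβ1
    have hn : nearMass m β ≠ ∞ := lintegral_near_ne_top hm hβ
    have hi : ∫⁻ y, ‖A y‖ₑ ≠ ∞ := hAi.2.ne
    refine ⟨nearMass m β * ENNReal.ofReal CA + ∫⁻ y, ‖A y‖ₑ, by finiteness, fun y => ?_⟩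
    refine pot_le (by linarith) hA.enorm (fun z => ?_) y
    rw [← ofReal_norm]
    exact ENNReal.ofReal_le_ofReal (hAb z)
  obtain ⟨K1, hK1, hK1'⟩ := hApot (β := α - γ₁) (by linarith) (by linarith)
  obtain ⟨K2, hK2, hK2'⟩ := hApot (β := α - γ₂) (by linarith) (by linarith)
  obtain ⟨K3, hK3, hK3'⟩ := hApot (β := γ₂ - s) (by linarith) (by linarith)
  obtain ⟨L1, hL1, hL1'⟩ := hvb (γ₁ - s) (by linarith) (by linarith)
  obtain ⟨L2, hL2, hL2'⟩ := hvb (α - γ₂) (by linarith) (by linarith)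
  obtain ⟨L3, hL3, hL3'⟩ := hvb (γ₂ - s) (by linarith) (by linarith)
  set P := pot (α - γ₁) (fun z => ‖A z‖ₑ) x
  set Q := pot (γ₁ - s) (fun z => ‖v z‖ₑ) x
  set R := pot (γ₂ - s) (fun y => ‖v y‖ₑ * pot (α - γ₂) (fun z => ‖A z‖ₑ) y) x with hR
  set S := pot (γ₂ - s) (fun y => pot (α - γ₂) (fun z => ‖v z‖ₑ) y * ‖A y‖ₑ) x with hS
  have hP : P ≠ ∞ := ne_top_of_le_ne_top hK1 (hK1' x)
  have hQ : Q ≠ ∞ := ne_top_of_le_ne_top hL1 (hL1' x)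
  have hRt : R ≠ ∞ := by
    have : R ≤ K2 * L3 := by
      calc R ≤ pot (γ₂ - s) (fun y => K2 * ‖v y‖ₑ) x :=
            pot_mono _ (fun y => by rw [mul_comm]; gcongr; exact hK2' y) x
        _ = K2 * pot (γ₂ - s) (fun y => ‖v y‖ₑ) x := pot_const_mul _ hv.enorm _ _
        _ ≤ _ := by gcongr; exact hL3' x
    exact ne_top_of_le_ne_top (by finiteness) this
  have hSt : S ≠ ∞ := by
    have : S ≤ L2 * K3 := by
      calc S ≤ pot (γ₂ - s) (fun y => L2 * ‖A y‖ₑ) x :=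
            pot_mono _ (fun y => by gcongr; exact hL2' y) x
        _ = L2 * pot (γ₂ - s) (fun y => ‖A y‖ₑ) x := pot_const_mul _ hA.enorm _ _
        _ ≤ _ := by gcongr; exact hK3' x
    exact ne_top_of_le_ne_top (by finiteness) this
  -- Both values of `a` are potentials of the same `A`, so their difference is an integral of the
  -- kernel difference.
  have hdiff : ∀ y, ‖a x - a y‖ₑ ≤ ENNReal.ofReal μ *
      ∫⁻ z, ENNReal.ofReal |‖x - z‖ ^ (-((m : ℝ) - α)) - ‖y - z‖ ^ (-((m : ℝ) - α))| * ‖A z‖ₑ := by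
    intro y
    rw [ha x, ha y, ← smul_sub, ← integral_sub (hAint x) (hAint y), enorm_smul,
      Real.enorm_of_nonneg hμ]
    gcongr
    refine (enorm_integral_le_lintegral_enorm _).trans (le_of_eq ?_)
    congr with z
    rw [← sub_smul, enorm_smul, Real.enorm_eq_ofReal_abs]
  have main : ∫⁻ y, ENNReal.ofReal (‖x - y‖ ^ (-((m : ℝ) + s))) * (‖a x - a y‖ₑ * ‖v y‖ₑ) ≤
      ENNReal.ofReal μ * (ENNReal.ofReal (kerConst m) * (P * Q + min R S)) := by
    refine le_trans ?_ (mul_le_mul_right (lintegral_kernel_le hm hα0 hα1 hs hsγ₁ hγ₁α hsγ₂ hγ₂α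
      hA.enorm hv.enorm x) (ENNReal.ofReal μ))
    rw [← lintegral_const_mul' _ _ ENNReal.ofReal_ne_top]
    refine lintegral_mono fun y => ?_
    calc _ ≤ ENNReal.ofReal (‖x - y‖ ^ (-((m : ℝ) + s))) * (ENNReal.ofReal μ *
          (∫⁻ z, ENNReal.ofReal |‖x - z‖ ^ (-((m : ℝ) - α)) - ‖y - z‖ ^ (-((m : ℝ) - α))| *
            ‖A z‖ₑ) * ‖v y‖ₑ) := by gcongr; exact hdiff y
      _ = ENNReal.ofReal μ * ((∫⁻ z,
          ENNReal.ofReal |‖x - z‖ ^ (-((m : ℝ) - α)) - ‖y - z‖ ^ (-((m : ℝ) - α))| * ‖A z‖ₑ) *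
            (ENNReal.ofReal (‖x - y‖ ^ (-((m : ℝ) + s))) * ‖v y‖ₑ)) := by ring
      _ = _ := by
          rw [← lintegral_mul_const' _ _ (by finiteness)]
          congr 2 with z
          rw [ENNReal.ofReal_mul (abs_nonneg _)]
          ring
  refine main.trans (le_of_eq ?_)
  have hc1 := pairConst_pos hm hα1 hs hsγ₁ hγ₁α
  have hc2 := pairConst_pos hm hα1 hs hsγ₂ hγ₂α
  have rR := pot_mul_rieszPotential (β := γ₂ - s) (by linarith : 0 < α - γ₂) (by linarith) hA
    hv.norm.measurable (fun _ => norm_nonneg _)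
    (fun y => ne_top_of_le_ne_top hK2 (hK2' y)) x
  have rS := pot_mul_rieszPotential (β := γ₂ - s) (by linarith : 0 < α - γ₂) (by linarith) hv
    hA.norm.measurable (fun _ => norm_nonneg _)
    (fun y => ne_top_of_le_ne_top hL2 (hL2' y)) x
  simp_rw [ofReal_norm] at rR rS
  simp_rw [mul_comm ‖A _‖, mul_comm ‖A _‖ₑ] at rS
  rw [← hR, mul_comm (rieszPotentialConst m (γ₂ - s)), ← pairConst] at rR
  rw [← hS, mul_comm (rieszPotentialConst m (γ₂ - s)), ← pairConst] at rS
  rw [rR, rS, rieszPotential_norm_eq_pot _ hA, rieszPotential_norm_eq_pot _ hv,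
    ← mul_min_of_nonneg _ _ hc2.le, inv_mul_cancel_left₀ hc2.ne', mul_mul_mul_comm, ← pairConst,
    inv_mul_cancel_left₀ hc1.ne', ENNReal.ofReal_mul (by positivity), ENNReal.ofReal_mul hμ,
    ENNReal.ofReal_add (by positivity) (le_min (by positivity) (by positivity)), ENNReal.ofReal_min,
    ENNReal.ofReal_mul (by positivity), ENNReal.ofReal_toReal hP, ENNReal.ofReal_toReal hQ,
    ENNReal.ofReal_toReal hRt, ENNReal.ofReal_toReal hSt, mul_assoc]

end

/-! ### Representation of a Schwartz function by its fractional Laplacian -/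

section

variable {m : ℕ} {𝕜 : Type*} [RCLike 𝕜]

lemma fracLaplacianConst_pos {s : ℝ} (hs : 0 < s) (hs1 : s < 1) : 0 < fracLaplacianConst m s := by
  have h1 := Real.Gamma_pos_of_pos (by positivity : 0 < ((m : ℝ) + s) / 2)
  have h2 : 0 < |Real.Gamma (-s / 2)| := by
    refine abs_pos.2 (Real.Gamma_ne_zero fun n hn => ?_)
    rcases Nat.eq_zero_or_pos n with rfl | h
    · simp only [CharP.cast_eq_zero, neg_zero] at hn; linarith
    · have : (1 : ℝ) ≤ n := by exact_mod_cast h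
      linarith
  have h3 := Real.pi_pos
  unfold fracLaplacianConst
  positivity

lemma exists_eq_integral_fracLaplacian (𝕜 : Type*) [RCLike 𝕜] (hm : 1 ≤ m) {α : ℝ} (hα : 0 < α)
    (hα1 : α < 1) : ∃ μ : ℝ, 0 ≤ μ ∧ ∀ (a : 𝓢(Eucl m, 𝕜)) (x : Eucl m),
      a x = μ • ∫ z, ‖x - z‖ ^ (-((m : ℝ) - α)) • fracLaplacian α a z := by
  obtain ⟨κ, hκ, h⟩ := exists_riesz_hyper 𝕜 hm hα hα1
  have hc := fracLaplacianConst_pos (m := m) hα hα1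
  refine ⟨(fracLaplacianConst m α * κ)⁻¹, by positivity, fun a x => ?_⟩
  rw [eq_inv_smul_iff₀ (by positivity), mul_smul, ← h a x,
    (lipDecay_schwartz a).bddLip.fracLaplacian_eq hm hα hα1, riesz_eq, ← integral_smul]
  congr with z
  rw [smul_comm]

lemma LipDecay.fracLaplacian_regularity (hm : 1 ≤ m) {α : ℝ} (hα : 0 < α) (hα1 : α < 1)
    {a : Eucl m → 𝕜} (ha : LipDecay a) :
    StronglyMeasurable (fracLaplacian α a) ∧ Integrable (fracLaplacian α a) ∧
      ∃ C : ℝ, ∀ y, ‖fracLaplacian α a y‖ ≤ C := by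
  rw [ha.bddLip.fracLaplacian_eq hm hα hα1]
  obtain ⟨C, hC⟩ := ha.bddLip.hyper_bounded hm hα hα1
  refine ⟨(stronglyMeasurable_hyper α ha.continuous).const_smul _,
    (ha.integrable_hyper' hm hα hα1).smul _, |fracLaplacianConst m α| * C, fun y => ?_⟩
  rw [norm_smul, Real.norm_eq_abs]
  gcongr
  exact hC y

lemma rieszPotential_nonneg {β : ℝ} (hβ : 0 < β) (hβm : β < m) {h : Eucl m → ℝ}
    (h0 : ∀ y, 0 ≤ h y) (x : Eucl m) : 0 ≤ rieszPotential β h x := by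
  unfold rieszPotential
  refine smul_nonneg (rieszPotentialConst_pos hβ hβm).le (integral_nonneg fun y => ?_)
  exact smul_nonneg (by positivity) (h0 y)

lemma BddLip.const_smul {F : Type*} [NormedAddCommGroup F] [NormedSpace ℝ F] {f : Eucl m → F}
    (hf : BddLip f) (c : ℝ) : BddLip fun x => c • f x := by
  obtain ⟨C, hC, h1, h2⟩ := hf
  refine ⟨|c| * C, by positivity, fun x => ?_, fun x y => ?_⟩
  · rw [norm_smul, Real.norm_eq_abs]; gcongr; exact h1 x
  · rw [← smul_sub, norm_smul, Real.norm_eq_abs, mul_assoc]; gcongr; exact h2 x y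

lemma LipDecay.pot_enorm_bounded {F : Type*} [NormedAddCommGroup F] (hm : 1 ≤ m) {β : ℝ}
    (hβ : 0 < β) (hβm : β ≤ m) {f : Eucl m → F} (hf : LipDecay f) :
    ∃ K : ℝ≥0∞, K ≠ ∞ ∧ ∀ y, pot β (fun z => ‖f z‖ₑ) y ≤ K := by
  obtain ⟨C, -, hC, -⟩ := hf.bddLip
  have hn : nearMass m β ≠ ∞ := lintegral_near_ne_top hm hβ
  have hi : ∫⁻ y, ‖f y‖ₑ ≠ ∞ := hf.integrable.2.ne
  refine ⟨nearMass m β * ENNReal.ofReal C + ∫⁻ y, ‖f y‖ₑ, by finiteness, fun y => ?_⟩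
  refine pot_le hβm hf.continuous.enorm.measurable (fun z => ?_) y
  rw [← ofReal_norm]
  exact ENNReal.ofReal_le_ofReal (hC z)

lemma LipDecay.pot_rieszPotential_bounded {F : Type*} [NormedAddCommGroup F] [NormedSpace ℝ F]
    (hm : 1 ≤ m) {β s : ℝ} (hβ : 0 < β) (hs : 0 < s) (h : β + s < m) {f : Eucl m → F}
    (hf : LipDecay f) :
    ∃ K : ℝ≥0∞, K ≠ ∞ ∧ ∀ y, pot β (fun z => ‖rieszPotential s f z‖ₑ) y ≤ K := by
  obtain ⟨C, -, hC, -⟩ := hf.bddLip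
  have hmeas : Measurable fun z => ‖f z‖ₑ := hf.continuous.enorm.measurable
  obtain ⟨K, hK, hK'⟩ := pot_pot_bounded hm hβ hs h hmeas
    (M := ENNReal.ofReal C) ENNReal.ofReal_ne_top
    (fun y => by rw [← ofReal_norm]; exact ENNReal.ofReal_le_ofReal (hC y)) hf.integrable.2.ne
  set c := ‖rieszPotentialConst m s‖ₑ with hc
  have hct : c ≠ ∞ := enorm_ne_top
  refine ⟨c * K, by finiteness, fun y => ?_⟩
  calc _ ≤ pot β (fun z => c * pot s (fun z => ‖f z‖ₑ) z) y := by
        refine pot_mono _ (fun z => ?_) y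
        unfold rieszPotential
        rw [enorm_smul]
        gcongr
        refine (enorm_integral_le_lintegral_enorm _).trans (le_of_eq ?_)
        unfold pot
        congr with w
        rw [enorm_smul, Real.enorm_of_nonneg (by positivity)]
    _ = c * pot β (pot s fun z => ‖f z‖ₑ) y := pot_const_mul _ (measurable_pot _ hmeas) _ _
    _ ≤ _ := by gcongr; exact hK' y

/-! ### The commutator with the Riesz potential -/

lemma LipDecay.bddLip_rieszPotential {F : Type*} [NormedAddCommGroup F] [NormedSpace ℝ F]
    (hm : 1 ≤ m) {s : ℝ} (hs : 0 < s) (hsm : s ≤ m) {f : Eucl m → F} (hf : LipDecay f) :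
    BddLip (rieszPotential s f) := by
  have : rieszPotential s f = fun x => rieszPotentialConst m s • riesz s f x :=
    funext (rieszPotential_eq s f)
  rw [this]
  exact (hf.bddLip_riesz hm hs hsm).const_smul _

/-- What matters is that `κ` does not depend on `f`: the commutator identity applies this to both
`b` and `ab`. -/
lemma exists_hyper_rieszPotential (𝕜 : Type*) [RCLike 𝕜] (hm : 1 ≤ m) {s : ℝ} (hs : 0 < s)
    (hs1 : s < 1) : ∃ κ : ℝ, ∀ (f : 𝓢(Eucl m, 𝕜)) (x : Eucl m),
      hyper s (rieszPotential s f) x = κ • f x := by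
  obtain ⟨κ, -, h⟩ := exists_riesz_hyper 𝕜 hm hs hs1
  refine ⟨rieszPotentialConst m s * κ, fun f x => ?_⟩
  rw [mul_smul, ← h f x, ← (lipDecay_schwartz f).hyper_riesz hm hs hs1]
  unfold hyper
  rw [← integral_smul]
  congr with w
  rw [rieszPotential_eq, rieszPotential_eq, ← smul_sub, smul_comm]

lemma bddLip_commutator_rieszPotential (hm : 1 ≤ m) {s : ℝ} (hs : 0 < s) (hs1 : s < 1)
    {a b : Eucl m → 𝕜} (ha : LipDecay a) (hb : LipDecay b) :
    BddLip (commutator a (rieszPotential s) b) := by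
  have hsm : s ≤ m := hs1.le.trans (by exact_mod_cast hm)
  exact (ha.bddLip.mul (hb.bddLip_rieszPotential hm hs hsm)).sub
    ((ha.mul hb).bddLip_rieszPotential hm hs hsm)

/-- Here the commutator structure enters. The term from `I_s[ab]` equals `a x * hyper s u x`, an
integral of `a x * (u x - u (x + w))`; subtracting it from the integral of `a x * u x - a (x + w) *
u (x + w)` leaves the difference of `a`. -/
lemma hyper_commutator_rieszPotential (hm : 1 ≤ m) {s : ℝ} (hs : 0 < s) (hs1 : s < 1)
    (a b : 𝓢(Eucl m, 𝕜)) (x : Eucl m) :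
    hyper s (commutator a (rieszPotential s) b) x =
      ∫ w, ‖w‖ ^ (-((m : ℝ) + s)) • ((a x - a (x + w)) * rieszPotential s b (x + w)) := by
  have hsm : s ≤ m := hs1.le.trans (by exact_mod_cast hm)
  have ha := lipDecay_schwartz a
  have hb := lipDecay_schwartz b
  obtain ⟨κ, hκ⟩ := exists_hyper_rieszPotential 𝕜 hm hs hs1
  set u := rieszPotential s b with hu
  set r := rieszPotential s (fun y => a y * b y) with hr
  have hub : BddLip u := hb.bddLip_rieszPotential hm hs hsm
  have hrb : BddLip r := (ha.mul hb).bddLip_rieszPotential hm hs hsm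
  have i1 := (ha.bddLip.mul hub).integrable_hyper hm hs hs1 x
  have i2 := hrb.integrable_hyper hm hs hs1 x
  have i3 := (hub.integrable_hyper hm hs hs1 x).const_mul (a x)
  have hr' : hyper s r x = a x * hyper s u x := by
    -- The inversion is stated for Schwartz functions, so the product `ab` is presented as one.
    have h1 := hκ (SchwartzMap.pairing (ContinuousLinearMap.mul 𝕜 𝕜) a b) x
    have h2 : (SchwartzMap.pairing (ContinuousLinearMap.mul 𝕜 𝕜) a b : Eucl m → 𝕜) =
        fun y => a y * b y := rfl
    rw [h2] at h1
    rw [hr, h1, hu, hκ b x, mul_smul_comm]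
  have e3 : a x * hyper s u x =
      ∫ w, a x * ‖w‖ ^ (-((m : ℝ) + s)) • (u x - u (x + w)) := (integral_const_mul _ _).symm
  calc hyper s (commutator a (rieszPotential s) b) x
      = (∫ w, ‖w‖ ^ (-((m : ℝ) + s)) • (a x * u x - a (x + w) * u (x + w))) - hyper s r x := by
        unfold hyper
        rw [← integral_sub i1 i2]
        congr with w
        rw [← smul_sub]
        congr 1
        change a x * u x - r x - (a (x + w) * u (x + w) - r (x + w)) = _
        ring
    _ = _ := by
        rw [hr', e3, ← integral_sub i1 i3]
        congr with w
        rw [mul_smul_comm, ← smul_sub]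
        congr 1
        ring

lemma exists_norm_fracLaplacian_commutator_le (𝕜 : Type*) [RCLike 𝕜] (hm : 1 ≤ m) {s δ γ : ℝ}
    (hs : 0 < s) (hsδ : s + δ < 1) (hsγ : s < γ) (hγ : γ < s + δ) :
    ∃ C : ℝ, ∀ (a b : 𝓢(Eucl m, 𝕜)) (x : Eucl m),
      ‖fracLaplacian s (commutator a (rieszPotential s) b) x‖ ≤
          C * (rieszPotential (s + δ - γ) (fun y => ‖fracLaplacian (s + δ) a y‖) x *
            rieszPotential (γ - s) (fun y => ‖rieszPotential s b y‖) x) +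
          C * min
            (rieszPotential (γ - s) (fun y => ‖rieszPotential s b y‖ *
              rieszPotential (s + δ - γ) (fun z => ‖fracLaplacian (s + δ) a z‖) y) x)
            (rieszPotential (γ - s) (fun y =>
              rieszPotential (s + δ - γ) (fun z => ‖rieszPotential s b z‖) y *
                ‖fracLaplacian (s + δ) a y‖) x) := by
  have hM : (1 : ℝ) ≤ m := by exact_mod_cast hm
  have hs1 : s < 1 := by linarith
  have hα0 : 0 < s + δ := by linarith
  obtain ⟨μ, hμ, hrep⟩ := exists_eq_integral_fracLaplacian (m := m) 𝕜 hm hα0 hsδ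
  have hc := fracLaplacianConst_pos (m := m) hs hs1
  have hK : 0 ≤ kerConst m := by unfold kerConst; positivity
  have hp := pairConst_pos hm hsδ hs.le hsγ hγ
  refine ⟨fracLaplacianConst m s * (μ * kerConst m * (pairConst m (s + δ) s γ)⁻¹),
    fun a b x => ?_⟩
  have ha := lipDecay_schwartz a
  have hb := lipDecay_schwartz b
  obtain ⟨hAm, hAi, CA, hAb⟩ := ha.fracLaplacian_regularity hm hα0 hsδ
  have hub : BddLip (rieszPotential s b) := hb.bddLip_rieszPotential hm hs (by linarith)
  have hub' := hub.continuous
  -- Both free exponents are set to `γ`, which gives a single constant for the two terms.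
  have main := lintegral_difference_le hm hα0 hsδ hs.le hsγ hγ hsγ hγ hμ (hrep a) hAm hAi hAb
    hub'.stronglyMeasurable (fun β hβ hβs =>
      hb.pot_rieszPotential_bounded hm hβ hs (by linarith)) x
  have hX1 := rieszPotential_nonneg (m := m) (β := s + δ - γ) (by linarith) (by linarith)
    (h := fun y => ‖fracLaplacian (s + δ) a y‖) (fun y => norm_nonneg _)
  have hX2 := rieszPotential_nonneg (m := m) (β := γ - s) (by linarith) (by linarith)
    (h := fun y => ‖rieszPotential s b y‖) (fun y => norm_nonneg _) x
  have hX3 := rieszPotential_nonneg (m := m) (β := s + δ - γ) (by linarith) (by linarith)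
    (h := fun y => ‖rieszPotential s b y‖) (fun y => norm_nonneg _)
  have hX4 := rieszPotential_nonneg (m := m) (β := γ - s) (by linarith) (by linarith)
    (h := fun y => ‖rieszPotential s b y‖ *
      rieszPotential (s + δ - γ) (fun z => ‖fracLaplacian (s + δ) a z‖) y)
    (fun y => mul_nonneg (norm_nonneg _) (hX1 y)) x
  have hX5 := rieszPotential_nonneg (m := m) (β := γ - s) (by linarith) (by linarith)
    (h := fun y => rieszPotential (s + δ - γ) (fun z => ‖rieszPotential s b z‖) y *
      ‖fracLaplacian (s + δ) a y‖)
    (fun y => mul_nonneg (hX3 y) (norm_nonneg _)) x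
  have hX1x := hX1 x
  set X1 := rieszPotential (s + δ - γ) (fun y => ‖fracLaplacian (s + δ) a y‖) x
  set X2 := rieszPotential (γ - s) (fun y => ‖rieszPotential s b y‖) x
  set X4 := rieszPotential (γ - s) (fun y => ‖rieszPotential s b y‖ *
      rieszPotential (s + δ - γ) (fun z => ‖fracLaplacian (s + δ) a z‖) y) x
  set X5 := rieszPotential (γ - s) (fun y =>
    rieszPotential (s + δ - γ) (fun z => ‖rieszPotential s b z‖) y *
      ‖fracLaplacian (s + δ) a y‖) x
  have hmin : 0 ≤ min X4 X5 := le_min hX4 hX5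
  have hhyper : ‖hyper s (commutator a (rieszPotential s) b) x‖ ≤
      μ * kerConst m * ((pairConst m (s + δ) s γ)⁻¹ * (X1 * X2) +
        (pairConst m (s + δ) s γ)⁻¹ * min X4 X5) := by
    rw [← ENNReal.ofReal_le_ofReal_iff (by positivity), ofReal_norm]
    refine le_trans ?_ main
    rw [hyper_commutator_rieszPotential hm hs hs1]
    refine (enorm_integral_le_lintegral_enorm _).trans (le_of_eq ?_)
    rw [← lintegral_add_left_eq_self (fun y => ENNReal.ofReal (‖x - y‖ ^ (-((m : ℝ) + s))) *
      (‖a x - a y‖ₑ * ‖rieszPotential s b y‖ₑ)) x]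
    congr with w
    rw [enorm_smul, enorm_mul, Real.enorm_of_nonneg (by positivity), sub_add_cancel_left, norm_neg]
  rw [(bddLip_commutator_rieszPotential hm hs hs1 ha hb).fracLaplacian_eq hm hs hs1, norm_smul,
    Real.norm_of_nonneg hc.le]
  calc _ ≤ fracLaplacianConst m s * (μ * kerConst m * ((pairConst m (s + δ) s γ)⁻¹ * (X1 * X2) +
        (pairConst m (s + δ) s γ)⁻¹ * min X4 X5)) := by gcongr
    _ = _ := by ring

/-! ### The commutator with the Riesz transforms -/

/-- The kernel of the `j`-th Riesz transform. -/
noncomputable def rieszKer (j : Fin m) (w : Eucl m) : ℝ := w j / ‖w‖ ^ (m + 1)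

lemma measurable_rieszKer (j : Fin m) : Measurable (rieszKer j) := by
  unfold rieszKer; fun_prop

lemma rieszKer_neg (j : Fin m) (w : Eucl m) : rieszKer j (-w) = -rieszKer j w := by
  simp [rieszKer, neg_div]

lemma abs_rieszKer_le (j : Fin m) (w : Eucl m) : |rieszKer j w| ≤ ‖w‖ ^ (-(m : ℝ)) := by
  rcases eq_or_ne w 0 with rfl | hw
  · simp only [rieszKer, PiLp.zero_apply, zero_div, abs_zero]; positivity
  have h0 : 0 < ‖w‖ := norm_pos_iff.2 hw
  have hj : |w j| ≤ ‖w‖ := PiLp.norm_apply_le w j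
  rw [rieszKer, abs_div, abs_of_pos (pow_pos h0 _), Real.rpow_neg h0.le, Real.rpow_natCast,
    div_le_iff₀ (by positivity), pow_succ, inv_mul_cancel_left₀ (by positivity)]
  exact hj

lemma rieszTransformIntegrand_eq {F : Type*} [NormedAddCommGroup F] [NormedSpace ℝ F] (j : Fin m)
    (f : Eucl m → F) (x y : Eucl m) :
    rieszTransformIntegrand j f x y = rieszKer j (x - y) • f y := rfl

lemma measurableSet_lt_norm_sub (x : Eucl m) (ε : ℝ) : MeasurableSet {y | ε < ‖x - y‖} :=
  measurableSet_lt measurable_const (by fun_prop)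

lemma integrableOn_rieszKer_smul {F : Type*} [NormedAddCommGroup F] [NormedSpace ℝ F] (j : Fin m)
    {f : Eucl m → F} (hf : Integrable f) (x : Eucl m) {ε : ℝ} (hε : 0 < ε) :
    IntegrableOn (fun y => rieszKer j (x - y) • f y) {y | ε < ‖x - y‖} := by
  refine Integrable.bdd_smul hf.integrableOn (ε ^ (-(m : ℝ)))
    ((measurable_rieszKer j).comp (measurable_const.sub measurable_id)).aestronglyMeasurable ?_
  filter_upwards [ae_restrict_mem (measurableSet_lt_norm_sub x ε)] with y hy
  refine (abs_rieszKer_le j _).trans ?_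
  exact Real.rpow_le_rpow_of_nonpos hε (le_of_lt hy) (by simp)

/-- Symmetrising about `x` replaces `f y` by a difference of size `O(‖x - y‖)`, which lowers the
singularity to the integrable `‖x - y‖^(-(m-1))`, the Riesz kernel of order 1. -/
lemma LipDecay.integrable_rieszKer_sub {F : Type*} [NormedAddCommGroup F] [NormedSpace ℝ F]
    (hm : 1 ≤ m) (j : Fin m) {f : Eucl m → F} (hf : LipDecay f) (x : Eucl m) :
    Integrable fun y => rieszKer j (x - y) • (f y - f (x + x - y)) := by
  have hM : (1 : ℝ) ≤ m := by exact_mod_cast hm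
  have hc := hf.continuous
  have hd := continuous_decay (m := m)
  obtain ⟨C, hC, -, h2⟩ := hf
  have hg : Integrable fun y : Eucl m => ‖x - y‖ ^ (-((m : ℝ) - 1)) •
      (decay y + decay (x + x - y)) := by
    refine integrable_ker_smul hm one_pos hM (by fun_prop : Continuous _).stronglyMeasurable
      (integrable_decay.add (integrable_decay.comp_sub_left _)) (C := 2) (fun y => ?_) x
    have h1 := decay_nonneg y
    have h2 := decay_nonneg (x + x - y)
    change ‖decay y + decay (x + x - y)‖ ≤ 2
    rw [Real.norm_of_nonneg (by positivity)]
    linarith [decay_le_one y, decay_le_one (x + x - y)]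
  refine (hg.const_mul (C * 2)).mono' ?_ (ae_of_all _ fun y => ?_)
  · exact ((measurable_rieszKer j).comp
      (measurable_const.sub measurable_id)).aestronglyMeasurable.smul
      (by fun_prop : Continuous _).aestronglyMeasurable
  · have h := h2 y (x + x - y)
    have hd1 := decay_nonneg y
    have hd2 := decay_nonneg (x + x - y)
    have hyy : ‖y - (x + x - y)‖ = 2 * ‖x - y‖ := by
      rw [show y - (x + x - y) = (-2 : ℝ) • (x - y) by module, norm_smul]; norm_num
    rw [hyy] at h
    rw [norm_smul, smul_eq_mul]
    have hker : ‖x - y‖ ^ (-(m : ℝ)) * min 1 (2 * ‖x - y‖) ≤ 2 * ‖x - y‖ ^ (-((m : ℝ) - 1)) := by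
      rcases eq_or_lt_of_le (norm_nonneg (x - y)) with h0 | h0
      · rw [← h0]; simp; positivity
      · calc _ ≤ ‖x - y‖ ^ (-(m : ℝ)) * (2 * ‖x - y‖) := by gcongr; exact min_le_right _ _
          _ = 2 * (‖x - y‖ ^ (-(m : ℝ)) * ‖x - y‖ ^ (1 : ℝ)) := by rw [Real.rpow_one]; ring
          _ = _ := by rw [← Real.rpow_add h0]; congr 2; ring
    calc _ ≤ ‖x - y‖ ^ (-(m : ℝ)) *
          (C * (min 1 (2 * ‖x - y‖) * (decay y + decay (x + x - y)))) := by
          gcongr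
          exact abs_rieszKer_le j _
      _ = C * (‖x - y‖ ^ (-(m : ℝ)) * min 1 (2 * ‖x - y‖)) * (decay y + decay (x + x - y)) := by
          ring
      _ ≤ C * (2 * ‖x - y‖ ^ (-((m : ℝ) - 1))) * (decay y + decay (x + x - y)) := by gcongr
      _ = _ := by ring

/-- The kernel is odd and the truncated domain is invariant under reflection in `x`, so `f` may be
replaced by its odd part about `x`. The principal value thereby becomes the limit of truncations of
an absolutely convergent integral. -/
lemma integral_rieszKer_eq_symm {F : Type*} [NormedAddCommGroup F] [NormedSpace ℝ F] (j : Fin m)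
    {f : Eucl m → F} (hf : Integrable f) (x : Eucl m) {ε : ℝ} (hε : 0 < ε) :
    ∫ y in {y | ε < ‖x - y‖}, rieszKer j (x - y) • f y =
      (1 / 2 : ℝ) • ∫ y in {y | ε < ‖x - y‖}, rieszKer j (x - y) • (f y - f (x + x - y)) := by
  have hS := measurableSet_lt_norm_sub x ε
  have hrefl : ∫ y in {y | ε < ‖x - y‖}, rieszKer j (x - y) • f (x + x - y) =
      -∫ y in {y | ε < ‖x - y‖}, rieszKer j (x - y) • f y := by
    rw [← integral_neg, ← integral_indicator hS, ← integral_indicator hS,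
      ← integral_sub_left_eq_self _ volume (x + x)]
    congr with y
    have hxy : x - (x + x - y) = -(x - y) := by abel
    by_cases hy : ε < ‖x - y‖
    · rw [indicator_of_mem (by rw [mem_ofPred_eq, hxy, norm_neg]; exact hy),
        indicator_of_mem (by exact hy), hxy, rieszKer_neg, sub_sub_cancel, neg_smul]
    · rw [indicator_of_notMem (by rw [mem_ofPred_eq, hxy, norm_neg]; exact hy),
        indicator_of_notMem (by exact hy)]
  have i1 := integrableOn_rieszKer_smul j hf x hε
  have i2 := integrableOn_rieszKer_smul j (hf.comp_sub_left (x + x)) x hε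
  simp_rw [smul_sub]
  rw [integral_sub i1 i2, hrefl, sub_neg_eq_add, ← two_smul ℝ, smul_smul]
  norm_num

lemma LipDecay.tendsto_truncRieszTransform {F : Type*} [NormedAddCommGroup F] [NormedSpace ℝ F]
    (hm : 1 ≤ m) (j : Fin m) {f : Eucl m → F} (hf : LipDecay f) (x : Eucl m) :
    ∃ v : F, Tendsto (truncRieszTransform j f x) (𝓝[>] 0) (𝓝 v) := by
  have h := (((aecover_norm_sub hm x).integral_tendsto_of_countably_generated
    (hf.integrable_rieszKer_sub hm j x)).const_smul (1 / 2 : ℝ)).const_smul (rieszTransformConst m)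
  refine ⟨_, h.congr' ?_⟩
  filter_upwards [self_mem_nhdsWithin] with ε hε
  rw [← integral_rieszKer_eq_symm j hf.integrable x hε]
  rfl

lemma LipDecay.rieszTransformExists {F : Type*} [NormedAddCommGroup F] [NormedSpace ℝ F]
    (hm : 1 ≤ m) (j : Fin m) {f : Eucl m → F} (hf : LipDecay f) (x : Eucl m) :
    RieszTransformExists j f x :=
  ⟨fun _ hε => integrableOn_rieszKer_smul j hf.integrable x hε,
    hf.tendsto_truncRieszTransform hm j x⟩

lemma LipDecay.tendsto_rieszTransform {F : Type*} [NormedAddCommGroup F] [NormedSpace ℝ F]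
    (hm : 1 ≤ m) (j : Fin m) {f : Eucl m → F} (hf : LipDecay f) (x : Eucl m) :
    Tendsto (truncRieszTransform j f x) (𝓝[>] 0) (𝓝 (rieszTransform j f x)) :=
  tendsto_nhds_limUnder (hf.tendsto_truncRieszTransform hm j x)

/-- The bound is uniform in `ε` and has the form of `lintegral_difference_le` with `s = 0`; no
principal value remains to be controlled. -/
lemma enorm_trunc_commutator_le (j : Fin m) {a b : Eucl m → 𝕜} (hab : Integrable fun y => a y * b y)
    (hb : Integrable b) (x : Eucl m) {ε : ℝ} (hε : 0 < ε) :
    ‖a x * truncRieszTransform j b x ε - truncRieszTransform j (fun y => a y * b y) x ε‖ₑ ≤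
      ‖rieszTransformConst m‖ₑ *
        ∫⁻ y, ENNReal.ofReal (‖x - y‖ ^ (-(m : ℝ))) * (‖a x - a y‖ₑ * ‖b y‖ₑ) := by
  have i1 := integrableOn_rieszKer_smul j (hb.const_mul (a x)) x hε
  have i2 := integrableOn_rieszKer_smul j hab x hε
  have e : a x * truncRieszTransform j b x ε - truncRieszTransform j (fun y => a y * b y) x ε =
      rieszTransformConst m • ∫ y in {y | ε < ‖x - y‖},
        rieszKer j (x - y) • ((a x - a y) * b y) := by
    unfold truncRieszTransform
    simp_rw [rieszTransformIntegrand_eq]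
    rw [mul_smul_comm, ← smul_sub, ← integral_const_mul]
    simp_rw [mul_smul_comm]
    rw [← integral_sub i1 i2]
    congr with y
    rw [← smul_sub, sub_mul]
  rw [e, enorm_smul]
  gcongr
  refine (enorm_integral_le_lintegral_enorm _).trans ((setLIntegral_le_lintegral _ _).trans ?_)
  refine lintegral_mono fun y => ?_
  rw [enorm_smul, enorm_mul, Real.enorm_eq_ofReal_abs]
  gcongr
  exact abs_rieszKer_le j _

lemma exists_norm_commutator_rieszTransform_le (𝕜 : Type*) [RCLike 𝕜] (hm : 1 ≤ m) (j : Fin m)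
    {δ : ℝ} (hδ : 0 < δ) (hδ1 : δ < 1) :
    ∃ C : ℝ → ℝ, ∀ γ₁ γ₂ : ℝ, 0 < γ₁ → γ₁ < δ → 0 < γ₂ → γ₂ < δ →
      ∀ (a b : 𝓢(Eucl m, 𝕜)) (x : Eucl m),
        ‖commutator a (rieszTransform j) b x‖ ≤
          C γ₁ * (rieszPotential (δ - γ₁) (fun y => ‖fracLaplacian δ a y‖) x *
            rieszPotential γ₁ (fun y => ‖b y‖) x) +
          C γ₂ * rieszPotential γ₂ (fun y =>
            rieszPotential (δ - γ₂) (fun z => ‖b z‖) y * ‖fracLaplacian δ a y‖) x := by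
  have hM : (1 : ℝ) ≤ m := by exact_mod_cast hm
  obtain ⟨μ, hμ, hrep⟩ := exists_eq_integral_fracLaplacian (m := m) 𝕜 hm hδ hδ1
  have hK : 0 ≤ kerConst m := by unfold kerConst; positivity
  -- Each exponent enters only through its own `pairConst`, so one function of `γ` gives both
  -- constants.
  refine ⟨fun γ => ‖rieszTransformConst m‖ * (μ * kerConst m * (pairConst m δ 0 γ)⁻¹),
    fun γ₁ γ₂ hγ₁ hγ₁δ hγ₂ hγ₂δ a b x => ?_⟩
  have ha := lipDecay_schwartz a
  have hb := lipDecay_schwartz b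
  have hp₁ := pairConst_pos hm hδ1 le_rfl hγ₁ hγ₁δ
  have hp₂ := pairConst_pos hm hδ1 le_rfl hγ₂ hγ₂δ
  obtain ⟨hAm, hAi, CA, hAb⟩ := ha.fracLaplacian_regularity hm hδ hδ1
  have main := lintegral_difference_le hm hδ hδ1 le_rfl hγ₁ hγ₁δ hγ₂ hγ₂δ hμ (hrep a) hAm hAi hAb
    b.continuous.stronglyMeasurable (fun β hβ hβs =>
      hb.pot_enorm_bounded hm hβ (by linarith)) x
  simp only [add_zero, sub_zero] at main
  have hX1 := rieszPotential_nonneg (m := m) (β := δ - γ₁) (by linarith) (by linarith)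
    (h := fun y => ‖fracLaplacian δ a y‖) (fun y => norm_nonneg _) x
  have hX2 := rieszPotential_nonneg (m := m) hγ₁ (by linarith)
    (h := fun y => ‖b y‖) (fun y => norm_nonneg _) x
  have hX3 := rieszPotential_nonneg (m := m) (β := δ - γ₂) (by linarith) (by linarith)
    (h := fun y => ‖b y‖) (fun y => norm_nonneg _)
  have hX5 := rieszPotential_nonneg (m := m) hγ₂ (by linarith)
    (h := fun y => rieszPotential (δ - γ₂) (fun z => ‖b z‖) y * ‖fracLaplacian δ a y‖)
    (fun y => mul_nonneg (hX3 y) (norm_nonneg _)) x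
  set X1 := rieszPotential (δ - γ₁) (fun y => ‖fracLaplacian δ a y‖) x
  set X2 := rieszPotential γ₁ (fun y => ‖b y‖) x
  set X5 := rieszPotential γ₂ (fun y =>
    rieszPotential (δ - γ₂) (fun z => ‖b z‖) y * ‖fracLaplacian δ a y‖) x
  -- Only the second entry of the minimum is kept.
  have main' := main.trans (ENNReal.ofReal_le_ofReal (mul_le_mul_of_nonneg_left
    (add_le_add_right (mul_le_mul_of_nonneg_left (min_le_right _ X5)
      (inv_nonneg.2 hp₂.le)) ((pairConst m δ 0 γ₁)⁻¹ * (X1 * X2))) (mul_nonneg hμ hK)))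
  have htend := ((hb.tendsto_rieszTransform hm j x).const_mul (a x)).sub
    ((ha.mul hb).tendsto_rieszTransform hm j x)
  -- The commutator is the limit of its truncations, each of which satisfies the bound.
  refine le_of_tendsto htend.norm ?_
  filter_upwards [self_mem_nhdsWithin] with ε hε
  have hle := (enorm_trunc_commutator_le j (ha.mul hb).integrable hb.integrable x hε).trans
    (mul_le_mul_right main' ‖rieszTransformConst m‖ₑ)
  rw [← ofReal_norm (rieszTransformConst m), ← ENNReal.ofReal_mul (norm_nonneg _), ← ofReal_norm,
    ENNReal.ofReal_le_ofReal_iff (by positivity)] at hle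
  refine hle.trans (le_of_eq ?_)
  ring

end

end FracComm

/-! ### Assembly of the two estimates -/

open FracComm
theorem lemma4p6 {𝕜 : Type*} [RCLike 𝕜] (m : ℕ) (hm : 1 ≤ m) :
    (∀ s δ γ : ℝ, 0 < s → 0 < δ → s + δ < 1 → s < γ → γ < s + δ →
      ∃ C : ℝ, ∀ (a b : 𝓢(EuclideanSpace ℝ (Fin m), 𝕜)) (x : EuclideanSpace ℝ (Fin m)),
        FracLaplacianExists (s + δ) a x ∧
        FracLaplacianExists s (FracComm.commutator a (rieszPotential s) b) x ∧
        ‖fracLaplacian s (FracComm.commutator a (rieszPotential s) b) x‖ ≤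
          C * (rieszPotential (s + δ - γ) (fun y => ‖fracLaplacian (s + δ) a y‖) x *
            rieszPotential (γ - s) (fun y => ‖rieszPotential s b y‖) x) +
          C * min
            (rieszPotential (γ - s) (fun y => ‖rieszPotential s b y‖ *
              rieszPotential (s + δ - γ) (fun z => ‖fracLaplacian (s + δ) a z‖) y) x)
            (rieszPotential (γ - s) (fun y =>
              rieszPotential (s + δ - γ) (fun z => ‖rieszPotential s b z‖) y *
                ‖fracLaplacian (s + δ) a y‖) x)) ∧
    (∀ (j : Fin m) (δ : ℝ), 0 < δ → δ < 1 →
      ∃ C : ℝ → ℝ, ∀ γ₁ γ₂ : ℝ, 0 < γ₁ → γ₁ < δ → 0 < γ₂ → γ₂ < δ →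
        ∀ (a b : 𝓢(EuclideanSpace ℝ (Fin m), 𝕜)) (x : EuclideanSpace ℝ (Fin m)),
          FracLaplacianExists δ a x ∧
          RieszTransformExists j b x ∧
          RieszTransformExists j (fun y => a y * b y) x ∧
          ‖FracComm.commutator a (rieszTransform j) b x‖ ≤
            C γ₁ * (rieszPotential (δ - γ₁) (fun y => ‖fracLaplacian δ a y‖) x *
              rieszPotential γ₁ (fun y => ‖b y‖) x) +
            C γ₂ * rieszPotential γ₂ (fun y =>
              rieszPotential (δ - γ₂) (fun z => ‖b z‖) y * ‖fracLaplacian δ a y‖) x) := by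

  have hM : (1 : ℝ) ≤ m := by exact_mod_cast hm
  refine ⟨fun s δ γ hs hδ hsδ hsγ hγ => ?_, fun j δ hδ hδ1 => ?_⟩
  · obtain ⟨C, hC⟩ := exists_norm_fracLaplacian_commutator_le 𝕜 hm hs hsδ hsγ hγ
    refine ⟨C, fun a b x => ⟨?_, ?_, hC a b x⟩⟩
    · exact fracLaplacianExists hm ((lipDecay_schwartz a).bddLip.integrable_fracLaplacianIntegrand
        hm (by linarith) hsδ x)
    · exact fracLaplacianExists hm ((bddLip_commutator_rieszPotential hm hs (by linarith)
        (lipDecay_schwartz a) (lipDecay_schwartz b)).integrable_fracLaplacianIntegrand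
        hm hs (by linarith) x)
  · obtain ⟨C, hC⟩ := exists_norm_commutator_rieszTransform_le 𝕜 hm j hδ hδ1
    refine ⟨C, fun γ₁ γ₂ h₁ h₁' h₂ h₂' a b x => ⟨?_, ?_, ?_, hC γ₁ γ₂ h₁ h₁' h₂ h₂' a b x⟩⟩
    · exact fracLaplacianExists hm ((lipDecay_schwartz a).bddLip.integrable_fracLaplacianIntegrand
        hm hδ hδ1 x)
    · exact (lipDecay_schwartz b).rieszTransformExists hm j x
    · exact ((lipDecay_schwartz a).mul (lipDecay_schwartz b)).rieszTransformExists hm j x
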